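/- Fix a horizon $T\ge 2$ and $K\ge 2$ arms. The true rewards $r_t(i)$ ($t=1,\dots,T$, $i=1,\dots,K$) are independent, $r_t(i)$ has a fixed unknown law $\nu_i$ on $[0,1]$ with mean $\mu_i$; the best arm $i^*$ is unique and $\Delta_i=\mu_{i^*}-\mu_i>0$ for $i\ne i^*$. In round $t$ the learner, on the basis of the pulled arms and observed rewards so far (and of internal randomness), pulls an arm $i_t$ and decides whether to verify the round. An attacker who knows $i_1,\dots,i_t$ and $r_1(i_1),\dots,r_t(i_t)$ (and may use randomness of its own) chooses a contamination $\epsilon_t$ with $r_t(i_t)+\epsilon_t\in[0,1]$. The learner observes $r_t(i_t)$ if the round is verified, and $r_t(i_t)+\epsilon_t$ otherwise. The regret is $R(T)=T\mu_{i^*}-\mathbb E\big[\sum_{t=1}^T r_t(i_t)\big]$. A best-arm identification (BAI) strategy consists of a sampling rule, a stopping rule and a recommendation rule, which depend only on past pulls and rewards (and on internal randomness). For $C\in\mathbb R$ and $\delta\in(0,1)$ we call it a fixed-confidence BAI strategy with confidence $\delta$ and constant $C$ if for all laws $\nu_1,\dots,\nu_K$ on $[0,1]$ with a unique best arm, when run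 on uncontaminated rewards without a horizon: (a) the probability that it stops and recommends an arm different from $i^*$ is at most $\delta$; (b) with probability at least $1-\delta$ it stops, having pulled each $j\neq i^*$ at most $C\,\Delta_j^{-2}\log\frac{K}{\delta\Delta_j}$ times, and having made at most $C\sum_{j\ne i^*}\Delta_j^{-2}\log\frac{K}{\delta\Delta_j}$ pulls in total. The Secure-ETC algorithm built on a BAI strategy follows the strategy and verifies every pull until the strategy stops (or the horizon $T$ is reached); afterwards it pulls the recommended arm in all remaining rounds, without verification. Then: 1. For every $C$ there is a constant $C'$, depending only on $C$, such that for all $K\ge2$, $T\ge2$, for every fixed-confidence BAI strategy with confidence $\delta=1/T$ and constant $C$, every attacker and all laws $\nu_1,\dots,\nu_K$ on $[0,1]$ with a unique best arm $i^*$, the Secure-ETC algorithm built on that strategy satisfies $$R(T)\le C'\sum_{i\ne i^*}\frac{\log T}{\Delta_i},\qquad \mathbb E[\text{number of verifications up to round } T]\le C'\sum_{i\neq i^*}\frac{\log T}{\Delta_i^2}.$$ 2. Such strategies exist: there is an absolute constant $C$ such that for all $K\ge 2$ and $\delta\in(0,1)$ there is a (deterministic) fixed-confidence BAI strategy with confidence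 $\delta$ and constant $C$. -/

import Mathlib

open MeasureTheory unitInterval

noncomputable section

namespace SecureBandit

/-- A history of length `n`: in each of the rounds `0, …, n - 1`, a pulled arm and a reward
in `[0, 1]`. -/
abbrev Hist (K n : ℕ) : Type := Fin n → Fin K × I

/-- The number of pulls of arm `i` in a history. -/
def Hist.count {K n : ℕ} (h : Hist K n) (i : Fin K) : ℕ :=
  (Finset.univ.filter fun k => (h k).1 = i).card

/-! ### The stochastic environment -/

/-- A reward table: `x t i` is the true reward of arm `i` in round `t`. -/
abbrev Table (K : ℕ) : Type := ℕ → Fin K → I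

/-- The law of the reward table: all the rewards `x t i` are independent, and `x t i` has the
distribution `ν i`. -/
def tableLaw {K : ℕ} (ν : Fin K → Measure I) [∀ i, IsProbabilityMeasure (ν i)] :
    Measure (Table K) :=
  Measure.infinitePi fun _ : ℕ => Measure.pi ν

/-- The expected reward of arm `i`. -/
def mean {K : ℕ} (ν : Fin K → Measure I) (i : Fin K) : ℝ :=
  ∫ r, (r : ℝ) ∂(ν i)

/-- `iStar` is the unique optimal arm. -/
def IsBestArm {K : ℕ} (ν : Fin K → Measure I) (iStar : Fin K) : Prop :=
  ∀ j, j ≠ iStar → mean ν j < mean ν iStar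

/-- The gap between the mean of the arm `iStar` and the mean of the arm `j`. -/
def gap {K : ℕ} (ν : Fin K → Measure I) (iStar j : Fin K) : ℝ :=
  mean ν iStar - mean ν j

/-! ### Learners with verification, attackers, and their interaction -/

/-- A learner with verification. Before round `n` it looks at its random seed and at the history of
its pulls and *observed* rewards; it chooses the arm to pull and whether to verify this round. -/
structure Learner (K : ℕ) (S : Type*) [MeasurableSpace S] where
  act : (n : ℕ) → S → Hist K n → Fin K
  verify : (n : ℕ) → S → Hist K n → Bool
  measurable_act : ∀ n, Measurable fun p : S × Hist K n => act n p.1 p.2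
  measurable_verify : ∀ n, Measurable fun p : S × Hist K n => verify n p.1 p.2

/-- An attacker. In round `n` it knows all pulled arms and all *true* rewards up to and including
round `n` (and its own random seed), and it chooses the reward `r_n + ε_n ∈ [0, 1]` that the learner
is going to observe if the round is not verified. -/
structure Attacker (K : ℕ) (A : Type*) [MeasurableSpace A] where
  corrupt : (n : ℕ) → A → Hist K (n + 1) → I
  measurable_corrupt : ∀ n, Measurable fun p : A × Hist K (n + 1) => corrupt n p.1 p.2

section Interaction

variable {K : ℕ} {S A : Type*} [MeasurableSpace S] [MeasurableSpace A]

/-- The first `n` rounds of the interaction. The first component is the history of pulled arms and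
true rewards, the second one the history of pulled arms and observed rewards. -/
def play (L : Learner K S) (B : Attacker K A) (s : S) (a : A) (x : Table K) :
    (n : ℕ) → Hist K n × Hist K n
  | 0 => (Fin.elim0, Fin.elim0)
  | n + 1 =>
    let h := play L B s a x n
    let i := L.act n s h.2
    let r := x n i
    let trueHist : Hist K (n + 1) := Fin.snoc h.1 (i, r)
    let o := if L.verify n s h.2 then r else B.corrupt n a trueHist
    (trueHist, Fin.snoc h.2 (i, o))

/-- The arm that is pulled in round `t`. -/
def pulledArm (L : Learner K S) (B : Attacker K A) (s : S) (a : A) (x : Table K) (t : ℕ) : Fin K :=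
  L.act t s (play L B s a x t).2

/-- The number of verified rounds among the first `T` rounds. -/
def numVerified (L : Learner K S) (B : Attacker K A) (s : S) (a : A) (x : Table K) (T : ℕ) : ℕ :=
  ((Finset.range T).filter fun t => L.verify t s (play L B s a x t).2 = true).card

/-- The joint law of the seed of the learner, the seed of the attacker and the reward table, which
are independent. -/
def jointLaw (ρ : Measure S) (α : Measure A) (ν : Fin K → Measure I)
    [∀ i, IsProbabilityMeasure (ν i)] : Measure (S × A × Table K) :=
  ρ.prod (α.prod (tableLaw ν))

/-- The regret `T μ_{i*} - 𝔼 [∑_{t < T} r_t(i_t)]`, in terms of the true rewards. -/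
def regret (L : Learner K S) (B : Attacker K A) (ρ : Measure S) (α : Measure A)
    (ν : Fin K → Measure I) [∀ i, IsProbabilityMeasure (ν i)] (iStar : Fin K) (T : ℕ) : ℝ :=
  T * mean ν iStar -
    ∫ p, ∑ t ∈ Finset.range T, (p.2.2 t (pulledArm L B p.1 p.2.1 p.2.2 t) : ℝ) ∂(jointLaw ρ α ν)

/-- The expected number of verifications in the first `T` rounds. -/
def expectedVerifications (L : Learner K S) (B : Attacker K A) (ρ : Measure S) (α : Measure A)
    (ν : Fin K → Measure I) [∀ i, IsProbabilityMeasure (ν i)] (T : ℕ) : ℝ :=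
  ∫ p, (numVerified L B p.1 p.2.1 p.2.2 T : ℝ) ∂(jointLaw ρ α ν)

end Interaction

/-! ### Best-arm identification -/

/-- A best-arm identification strategy: a sampling rule, a stopping rule and a recommendation rule,
all of them functions of a random seed and of the history of pulls and rewards. -/
structure BAI (K : ℕ) (S : Type*) [MeasurableSpace S] where
  sample : (n : ℕ) → S → Hist K n → Fin K
  halt : (n : ℕ) → S → Hist K n → Bool
  recommend : (n : ℕ) → S → Hist K n → Fin K
  measurable_sample : ∀ n, Measurable fun p : S × Hist K n => sample n p.1 p.2
  measurable_halt : ∀ n, Measurable fun p : S × Hist K n => halt n p.1 p.2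
  measurable_recommend : ∀ n, Measurable fun p : S × Hist K n => recommend n p.1 p.2

namespace BAI

variable {K : ℕ} {S : Type*} [MeasurableSpace S]

/-- The history after `n` pulls of the sampling rule in the environment without attacks. -/
def hist (E : BAI K S) (s : S) (x : Table K) : (n : ℕ) → Hist K n
  | 0 => Fin.elim0
  | n + 1 =>
    let i := E.sample n s (hist E s x n)
    Fin.snoc (hist E s x n) (i, x n i)

/-- The strategy stops after exactly `n` pulls. -/
def StopsAt (E : BAI K S) (s : S) (x : Table K) (n : ℕ) : Prop :=
  E.halt n s (E.hist s x n) = true ∧ ∀ m < n, E.halt m s (E.hist s x m) = false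

/-- The pulls that the strategy may use to discard an arm of gap `Δ` at confidence `δ`, up to a
constant factor: `log (K / (δ Δ)) / Δ ^ 2`. -/
def complexity (K : ℕ) (δ Δ : ℝ) : ℝ :=
  Real.log (K / (δ * Δ)) / Δ ^ 2

/-- `E` is a fixed-confidence strategy at confidence level `δ`, with constant `C`. On every
bandit instance with rewards in `[0, 1]` and a unique best arm,
* the probability that it stops and recommends a wrong arm is at most `δ`;
* with probability at least `1 - δ` it stops, after pulling every suboptimal arm `j` at most
  `C log (K / (δ Δ_j)) / Δ_j ^ 2` times, and after at most `C ∑_j log (K / (δ Δ_j)) / Δ_j ^ 2`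
  pulls in total. -/
structure IsFixedConfidence (E : BAI K S) (ρ : Measure S) (C δ : ℝ) : Prop where
  correct : ∀ (ν : Fin K → Measure I) [∀ i, IsProbabilityMeasure (ν i)] (iStar : Fin K),
    IsBestArm ν iStar →
    (ρ.prod (tableLaw ν)) {p | ∃ n, E.StopsAt p.1 p.2 n ∧
      E.recommend n p.1 (E.hist p.1 p.2 n) ≠ iStar} ≤ ENNReal.ofReal δ
  sample_complexity : ∀ (ν : Fin K → Measure I) [∀ i, IsProbabilityMeasure (ν i)] (iStar : Fin K),
    IsBestArm ν iStar →
    ENNReal.ofReal (1 - δ) ≤ (ρ.prod (tableLaw ν)) {p | ∃ n, E.StopsAt p.1 p.2 n ∧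
      (∀ j, j ≠ iStar →
        ((E.hist p.1 p.2 n).count j : ℝ) ≤ C * complexity K δ (gap ν iStar j)) ∧
      (n : ℝ) ≤ C * ∑ j ∈ Finset.univ.erase iStar, complexity K δ (gap ν iStar j)}

/-! ### Explore-then-commit -/

/-- The arm to which explore-then-commit has committed after the history `h`: the recommendation of
`E` at the first time at which `E` stops along `h`, and `none` if `E` has not stopped yet. -/
def committed (E : BAI K S) : (n : ℕ) → S → Hist K n → Option (Fin K)
  | 0, s, h => if E.halt 0 s h then some (E.recommend 0 s h) else none
  | n + 1, s, h =>
    match committed E n s (Fin.init h) with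
    | some i => some i
    | none => if E.halt (n + 1) s h then some (E.recommend (n + 1) s h) else none

theorem measurable_init {K : ℕ} (n : ℕ) :
    Measurable fun h : Hist K (n + 1) => (Fin.init h : Hist K n) :=
  measurable_pi_lambda _ fun k => measurable_pi_apply k.castSucc

theorem measurableSet_committed (E : BAI K S) (n : ℕ) (o : Option (Fin K)) :
    MeasurableSet {p : S × Hist K n | E.committed n p.1 p.2 = o} := by
  have key : ∀ (m : ℕ) (o : Option (Fin K)), MeasurableSet {p : S × Hist K m |
      (if E.halt m p.1 p.2 then some (E.recommend m p.1 p.2) else none) = o} := by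
    intro m o
    have h : Measurable fun p : S × Hist K m => (E.halt m p.1 p.2, E.recommend m p.1 p.2) :=
      (E.measurable_halt m).prodMk (E.measurable_recommend m)
    exact h (MeasurableSet.of_discrete
      (s := {q : Bool × Fin K | (if q.1 then some q.2 else none) = o}))
  induction n generalizing o with
  | zero => exact key 0 o
  | succ n ih =>
    have hm : Measurable fun p : S × Hist K (n + 1) => (p.1, (Fin.init p.2 : Hist K n)) :=
      measurable_fst.prodMk ((measurable_init n).comp measurable_snd)
    have hset : {p : S × Hist K (n + 1) | E.committed (n + 1) p.1 p.2 = o} =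
        (⋃ i : Fin K, {p | E.committed n p.1 (Fin.init p.2) = some i ∧ some i = o}) ∪
        ({p | E.committed n p.1 (Fin.init p.2) = none} ∩
          {p | (if E.halt (n + 1) p.1 p.2 then some (E.recommend (n + 1) p.1 p.2) else none)
            = o}) := by
      ext p
      simp only [committed, Set.mem_ofPred_eq, Set.mem_union, Set.mem_iUnion, Set.mem_inter_iff]
      cases E.committed n p.1 (Fin.init p.2) <;> simp
    rw [hset]
    refine (MeasurableSet.iUnion fun i => ?_).union ((hm (ih none)).inter (key (n + 1) o))
    exact (hm (ih (some i))).inter (MeasurableSet.const _)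

/-- Explore-then-commit with exploration phase `E`: follow `E` and verify every pull until `E`
stops, then pull the recommended arm forever without verification. -/
def exploreThenCommit (E : BAI K S) : Learner K S where
  act n s h := (E.committed n s h).getD (E.sample n s h)
  verify n s h := (E.committed n s h).isNone
  measurable_act n := by
    refine measurable_to_countable' fun i => ?_
    have hset : (fun p : S × Hist K n =>
          (E.committed n p.1 p.2).getD (E.sample n p.1 p.2)) ⁻¹' {i} =
        {p | E.committed n p.1 p.2 = some i} ∪
        ({p | E.committed n p.1 p.2 = none} ∩ {p | E.sample n p.1 p.2 = i}) := by
      ext p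
      simp only [Set.mem_preimage, Set.mem_singleton_iff, Set.mem_union, Set.mem_ofPred_eq,
        Set.mem_inter_iff]
      cases E.committed n p.1 p.2 <;> simp
    rw [hset]
    exact (E.measurableSet_committed n _).union ((E.measurableSet_committed n _).inter
      (E.measurable_sample n (measurableSet_singleton i)))
  measurable_verify n := by
    refine measurable_to_bool ?_
    have hset : (fun p : S × Hist K n => (E.committed n p.1 p.2).isNone) ⁻¹' {true} =
        {p | E.committed n p.1 p.2 = none} := by
      ext p
      simp
    rw [hset]
    exact E.measurableSet_committed n none

end BAI

end SecureBandit

end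

open ProbabilityTheory

namespace SecureBandit

variable {K : ℕ}

/-! Part 1. While the strategy explores, every pull is verified, so the observed history is exactly
the history of the uncontaminated strategy on the same reward table (`BAI.play_exploreThenCommit`).
Once it stops, the committed arm is fixed and later observations are irrelevant. The attacker
therefore has no influence on the arms or on the verifications. The arm of round `t` is determined
by the seeds and the earlier rounds, so the regret is the expected sum of the gaps of the pulled
arms (`regret_eq_integral_gap`). With `δ = 1 / T`, exceeding the budgets or recommending a wrong arm
has probability at most `2 / T` and costs at most `T`, so it adds at most `2`. Otherwise only
exploration pulls suboptimal arms.

It remains to replace `log (K T / Δ)` by `log T`. If `K ≤ T` and `Δ ≥ 1 / T`, then `K T / Δ ≤ T ^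
3`. If `Δ < 1 / T`, the trivial bound `T` is below `2 log T / Δ ^ 2`. If `K > T`, it is below the
number of suboptimal arms, which the target sums dominate.

Part 2. The strategy pulls a least pulled arm among those whose confidence interval is not below
another one. Hoeffding's lemma makes the exponential of the capped deviations of an arm a
supermartingale (`BAI.integral_expDev_le_one`). This gives a Chernoff bound for the first `m`
rewards of an arm, whenever they are pulled, and a union bound over arms and `m` makes all intervals
valid with probability at least `1 - δ`. The best arm then stays a candidate. The pulled arm has the
largest radius among the candidates, so its gap is at most four times its own radius, which bounds
its count. A pull of the best arm is charged to another candidate. -/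

instance (ν : Fin K → Measure I) [∀ i, IsProbabilityMeasure (ν i)] :
    IsProbabilityMeasure (tableLaw ν) :=
  inferInstanceAs (IsProbabilityMeasure (Measure.infinitePi _))

/-! ### Independence of a round from the past -/

/-- The reward of arm `i` in round `n` has law `ν i`. -/
theorem measurePreserving_reward (ν : Fin K → Measure I) [∀ i, IsProbabilityMeasure (ν i)]
    (n : ℕ) (i : Fin K) : MeasurePreserving (fun x : Table K => x n i) (tableLaw ν) (ν i) :=
  (measurePreserving_eval ν i).comp (measurePreserving_eval_infinitePi (fun _ => Measure.pi ν) n)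

/-- A function of the rounds before `n` is independent of round `n`. -/
theorem indepFun_round (ν : Fin K → Measure I) [∀ i, IsProbabilityMeasure (ν i)] {n : ℕ}
    {β : Type*} [MeasurableSpace β] {g : Table K → β} (hg : Measurable g)
    (hd : DependsOn g (Set.Iio n)) : IndepFun g (fun x => x n) (tableLaw ν) := by
  have h0 : iIndepFun (fun (t : ℕ) (x : Table K) => x t) (tableLaw ν) :=
    iIndepFun_infinitePi (X := fun _ => id) fun _ => measurable_id
  have h1 := h0.indepFun_finset (Finset.range n) {n} (by simp) fun t => measurable_pi_apply t
  -- Padding with zeros exhibits `g` as a function of the finite block of rounds before `n`; `hd`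
  -- makes the padded values irrelevant.
  let ext : (Finset.range n → Fin K → I) → Table K :=
    fun y t => if h : t ∈ Finset.range n then y ⟨t, h⟩ else fun _ => 0
  have hext : Measurable ext := by
    refine measurable_pi_lambda _ fun t => ?_
    by_cases h : t ∈ Finset.range n
    · simpa only [ext, h, dite_true] using measurable_pi_apply _
    · simpa only [ext, h, dite_false] using measurable_const
  have h2 := h1.comp (hg.comp hext)
    (measurable_pi_apply (⟨n, Finset.mem_singleton_self n⟩ : ({n} : Finset ℕ)))
  convert h2 using 1
  · funext x
    refine hd fun t ht => ?_
    simp [ext, Set.mem_Iio.1 ht]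
  · rfl

/-- The fresh reward factors out of anything decided by the past. The arm is fixed here, so only the
marginal law `ν i` enters. -/
theorem integral_mul_reward (ν : Fin K → Measure I) [∀ i, IsProbabilityMeasure (ν i)] {n : ℕ}
    {g : Table K → ℝ} (hg : Measurable g) (hd : DependsOn g (Set.Iio n)) {φ : I → ℝ}
    (hφ : Measurable φ) (i : Fin K) :
    ∫ x, g x * φ (x n i) ∂(tableLaw ν) = (∫ x, g x ∂(tableLaw ν)) * ∫ r, φ r ∂(ν i) := by
  have hφi : Measurable fun y : Fin K → I => φ (y i) := hφ.comp (measurable_pi_apply i)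
  have h := ((indepFun_round ν hg hd).comp measurable_id hφi).integral_fun_mul_eq_mul_integral
    hg.aestronglyMeasurable (hφi.comp (measurable_pi_apply n)).aestronglyMeasurable
  have h2 := (measurePreserving_reward ν n i).map_eq
  rw [← h2, integral_map (measurePreserving_reward ν n i).measurable.aemeasurable
    hφ.aestronglyMeasurable]
  exact h

/-! ### Measurability of the interaction -/

theorem measurable_eval_arm {Ω β : Type*} [MeasurableSpace Ω] [MeasurableSpace β]
    {f : Ω → Fin K → β} {i : Ω → Fin K} (hf : Measurable f) (hi : Measurable i) :
    Measurable fun ω => f ω (i ω) := by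
  have h : Measurable fun p : (Fin K → β) × Fin K => p.1 p.2 :=
    measurable_from_prod_countable_left fun i => measurable_pi_apply i
  exact h.comp (hf.prodMk hi)

theorem measurable_snoc {Ω : Type*} [MeasurableSpace Ω] {n : ℕ} {h : Ω → Hist K n}
    {q : Ω → Fin K × I} (hh : Measurable h) (hq : Measurable q) :
    Measurable fun ω => (Fin.snoc (h ω) (q ω) : Hist K (n + 1)) := by
  refine measurable_pi_lambda _ fun k => ?_
  induction k using Fin.lastCases with
  | last => simpa using hq
  | cast k => simpa using hh.eval (a := k)

theorem measurable_round {n : ℕ} : Measurable fun x : Table K => x n := measurable_pi_apply n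

section Learner

variable {S A : Type*} [MeasurableSpace S] [MeasurableSpace A]

theorem measurable_play (L : Learner K S) (B : Attacker K A) (n : ℕ) :
    Measurable fun p : S × A × Table K => play L B p.1 p.2.1 p.2.2 n := by
  induction n with
  | zero => exact measurable_const
  | succ n ih =>
    have h2 : Measurable fun p : S × A × Table K => (p.1, (play L B p.1 p.2.1 p.2.2 n).2) :=
      measurable_fst.prodMk ih.snd
    have hi := (L.measurable_act n).comp h2
    have hr : Measurable fun p : S × A × Table K =>
        p.2.2 n (L.act n p.1 (play L B p.1 p.2.1 p.2.2 n).2) :=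
      measurable_eval_arm (measurable_round.comp (measurable_snd.comp measurable_snd)) hi
    have ht := measurable_snoc ih.fst (hi.prodMk hr)
    refine ht.prodMk (measurable_snoc ih.snd (hi.prodMk ?_))
    refine Measurable.ite ?_ hr ((B.measurable_corrupt n).comp
      ((measurable_fst.comp measurable_snd).prodMk ht))
    exact (L.measurable_verify n).comp h2 (measurableSet_singleton true)

/-- For fixed seeds, round `n` of the table is read only when that round is played, by the learner
and the attacker alike. This is what makes the choice of arm independent of the fresh reward. -/
theorem dependsOn_play (L : Learner K S) (B : Attacker K A) (s : S) (a : A) (n : ℕ) :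
    DependsOn (fun x => play L B s a x n) (Set.Iio n) := by
  induction n with
  | zero => intro x y _; rfl
  | succ n ih =>
    intro x y hxy
    have h1 := ih fun t (ht : t < n) => hxy t (ht.trans n.lt_succ_self)
    have h2 : x n = y n := hxy n n.lt_succ_self
    simp only at h1
    simp only [play, h1, h2]

theorem measurable_pulledArm (L : Learner K S) (B : Attacker K A) (t : ℕ) :
    Measurable fun p : S × A × Table K => pulledArm L B p.1 p.2.1 p.2.2 t :=
  (L.measurable_act t).comp (measurable_fst.prodMk (measurable_play L B t).snd)

end Learner

namespace BAI

variable {S : Type*} [MeasurableSpace S]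

theorem measurable_hist (E : BAI K S) (n : ℕ) :
    Measurable fun p : S × Table K => E.hist p.1 p.2 n := by
  induction n with
  | zero => exact measurable_const
  | succ n ih =>
    have hi := (E.measurable_sample n).comp (measurable_fst.prodMk ih)
    exact measurable_snoc ih
      (hi.prodMk (measurable_eval_arm (measurable_round.comp measurable_snd) hi))

theorem dependsOn_hist (E : BAI K S) (s : S) (n : ℕ) :
    DependsOn (fun x => E.hist s x n) (Set.Iio n) := by
  induction n with
  | zero => intro x y _; rfl
  | succ n ih =>
    intro x y hxy
    have h1 := ih fun t (ht : t < n) => hxy t (ht.trans n.lt_succ_self)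
    have h2 : x n = y n := hxy n n.lt_succ_self
    simp only at h1
    simp only [hist, h1, h2]

theorem measurableSet_stopsAt (E : BAI K S) (n : ℕ) :
    MeasurableSet {p : S × Table K | E.StopsAt p.1 p.2 n} := by
  have h (m : ℕ) : Measurable fun p : S × Table K => E.halt m p.1 (E.hist p.1 p.2 m) :=
    (E.measurable_halt m).comp (measurable_fst.prodMk (E.measurable_hist m))
  have h' : {p : S × Table K | E.StopsAt p.1 p.2 n} =
      {p | E.halt n p.1 (E.hist p.1 p.2 n) = true} ∩
        ⋂ m, ⋂ (_ : m < n), {p | E.halt m p.1 (E.hist p.1 p.2 m) = false} := by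
    ext p
    simp [StopsAt]
  rw [h']
  exact (h n (measurableSet_singleton true)).inter (MeasurableSet.iInter fun m =>
    MeasurableSet.iInter fun _ => h m (measurableSet_singleton false))

end BAI

theorem measurable_count {n : ℕ} (i : Fin K) : Measurable fun h : Hist K n => h.count i := by
  simp only [Hist.count, Finset.card_filter]
  refine Finset.measurable_sum _ fun k _ => Measurable.ite ?_ measurable_const measurable_const
  exact (measurable_fst.comp (measurable_pi_apply k)) (measurableSet_singleton i)

theorem count_snoc {n : ℕ} (h : Hist K n) (q : Fin K × I) (i : Fin K) :
    Hist.count (Fin.snoc h q : Hist K (n + 1)) i = h.count i + if q.1 = i then 1 else 0 := by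
  simp only [Hist.count, Finset.card_filter, Fin.sum_univ_castSucc, Fin.snoc_castSucc,
    Fin.snoc_last]

/-! ### Elementary facts on means and gaps -/

section Mean

variable (ν : Fin K → Measure I)

theorem integrable_coe [∀ i, IsProbabilityMeasure (ν i)] (i : Fin K) : Integrable (fun r : I => (r : ℝ)) (ν i) :=
  Integrable.of_bound measurable_subtype_coe.aestronglyMeasurable 1
    (Filter.Eventually.of_forall fun r => by
      rw [Real.norm_of_nonneg r.2.1]; exact r.2.2)

theorem mean_nonneg (i : Fin K) : 0 ≤ mean ν i := integral_nonneg fun r => r.2.1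

theorem mean_le_one [∀ i, IsProbabilityMeasure (ν i)] (i : Fin K) : mean ν i ≤ 1 := by
  have h := integral_mono (integrable_coe ν i) (integrable_const (1 : ℝ)) fun r => r.2.2
  simpa [mean] using h

theorem gap_le_one [∀ i, IsProbabilityMeasure (ν i)] (i j : Fin K) : gap ν i j ≤ 1 := by
  have h1 := mean_le_one ν i
  have h2 := mean_nonneg ν j
  unfold gap
  linarith

theorem gap_self (i : Fin K) : gap ν i i = 0 := sub_self _

variable {ν}

theorem IsBestArm.gap_pos {iStar j : Fin K} (h : IsBestArm ν iStar) (hj : j ≠ iStar) :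
    0 < gap ν iStar j := sub_pos.2 (h j hj)

end Mean

/-! ### Regret as the expected sum of gaps -/

section Regret

variable {S A : Type*} [MeasurableSpace S] [MeasurableSpace A]

/-- The arm is random, but for fixed seeds it depends on earlier rounds only; corrupting past
observations cannot correlate it with the current reward. -/
theorem integral_reward_pulledArm (L : Learner K S) (B : Attacker K A) (s : S) (a : A)
    (ν : Fin K → Measure I) [∀ i, IsProbabilityMeasure (ν i)] (t : ℕ) :
    ∫ x, (x t (pulledArm L B s a x t) : ℝ) ∂(tableLaw ν) =
      ∫ x, mean ν (pulledArm L B s a x t) ∂(tableLaw ν) := by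
  have hm : Measurable fun x : Table K => pulledArm L B s a x t :=
    (measurable_pulledArm L B t).comp (measurable_const.prodMk (measurable_const.prodMk
      measurable_id))
  have hmi (i : Fin K) :
      Measurable fun x : Table K => if pulledArm L B s a x t = i then (1 : ℝ) else 0 :=
    Measurable.ite (hm (measurableSet_singleton i)) measurable_const measurable_const
  have hb (i : Fin K) (x : Table K) :
      ‖if pulledArm L B s a x t = i then (1 : ℝ) else 0‖ ≤ 1 := by
    split_ifs <;> simp
  have hd (i : Fin K) : DependsOn (fun x : Table K =>
      if pulledArm L B s a x t = i then (1 : ℝ) else 0) (Set.Iio t) := by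
    intro x y hxy
    have h := dependsOn_play L B s a t hxy
    simp only at h
    have h' : pulledArm L B s a x t = pulledArm L B s a y t := by simp only [pulledArm, h]
    simp only [h']
  have hint (i : Fin K) : Integrable (fun x : Table K =>
      if pulledArm L B s a x t = i then (1 : ℝ) else 0) (tableLaw ν) :=
    Integrable.of_bound (hmi i).aestronglyMeasurable 1 (Filter.Eventually.of_forall (hb i))
  -- Splitting by the value of the pulled arm makes each summand a past indicator times a fixed
  -- coordinate of round `t`.
  have e1 (x : Table K) : (x t (pulledArm L B s a x t) : ℝ) =
      ∑ i, (if pulledArm L B s a x t = i then (1 : ℝ) else 0) * (x t i : ℝ) := by simp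
  have e2 (x : Table K) : mean ν (pulledArm L B s a x t) =
      ∑ i, (if pulledArm L B s a x t = i then (1 : ℝ) else 0) * mean ν i := by simp
  simp_rw [e1, e2]
  rw [integral_finsetSum, integral_finsetSum]
  · refine Finset.sum_congr rfl fun i _ => ?_
    rw [integral_mul_const]
    exact integral_mul_reward ν (hmi i) (hd i) measurable_subtype_coe i
  · exact fun i _ => (hint i).mul_const _
  · refine fun i _ => Integrable.of_bound ((hmi i).mul (measurable_subtype_coe.comp
      (measurePreserving_reward ν t i).measurable)).aestronglyMeasurable 1
      (Filter.Eventually.of_forall fun x => ?_)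
    have h1 := (x t i).2.1
    have h2 := (x t i).2.2
    split_ifs
    · rw [one_mul, Real.norm_of_nonneg h1]; exact h2
    · simp

theorem measurable_gap_pulledArm (L : Learner K S) (B : Attacker K A) (f : Fin K → ℝ) (t : ℕ) :
    Measurable fun p : S × A × Table K => f (pulledArm L B p.1 p.2.1 p.2.2 t) :=
  (measurable_of_finite f).comp (measurable_pulledArm L B t)

theorem regret_eq_integral_gap (L : Learner K S) (B : Attacker K A) (ρ : Measure S)
    [IsProbabilityMeasure ρ] (α : Measure A) [IsProbabilityMeasure α]
    (ν : Fin K → Measure I) [∀ i, IsProbabilityMeasure (ν i)] (iStar : Fin K) (T : ℕ) :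
    regret L B ρ α ν iStar T =
      ∫ p, ∑ t ∈ Finset.range T, gap ν iStar (pulledArm L B p.1 p.2.1 p.2.2 t)
        ∂(jointLaw ρ α ν) := by
  have : IsProbabilityMeasure (jointLaw ρ α ν) := by unfold jointLaw; infer_instance
  have hr (t : ℕ) : Integrable (fun p : S × A × Table K =>
      (p.2.2 t (pulledArm L B p.1 p.2.1 p.2.2 t) : ℝ)) (jointLaw ρ α ν) := by
    refine Integrable.of_bound (measurable_subtype_coe.comp (measurable_eval_arm
      (measurable_round.comp (measurable_snd.comp measurable_snd))
      (measurable_pulledArm L B t))).aestronglyMeasurable 1 (Filter.Eventually.of_forall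
      fun p => ?_)
    rw [Real.norm_of_nonneg (p.2.2 t _).2.1]
    exact (p.2.2 t _).2.2
  have hm (t : ℕ) : Integrable (fun p : S × A × Table K =>
      mean ν (pulledArm L B p.1 p.2.1 p.2.2 t)) (jointLaw ρ α ν) := by
    refine Integrable.of_bound (measurable_gap_pulledArm L B _ t).aestronglyMeasurable 1
      (Filter.Eventually.of_forall fun p => ?_)
    rw [Real.norm_of_nonneg (mean_nonneg ν _)]
    exact mean_le_one ν _
  have he (t : ℕ) : ∫ p, (p.2.2 t (pulledArm L B p.1 p.2.1 p.2.2 t) : ℝ) ∂(jointLaw ρ α ν) =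
      ∫ p, mean ν (pulledArm L B p.1 p.2.1 p.2.2 t) ∂(jointLaw ρ α ν) := by
    have hr' := hr t
    have hm' := hm t
    unfold jointLaw at hr' hm' ⊢
    rw [integral_prod _ hr', integral_prod _ hm']
    refine integral_congr_ae ?_
    filter_upwards [hr'.prod_right_ae, hm'.prod_right_ae] with s h1 h2
    rw [integral_prod _ h1, integral_prod _ h2]
    exact integral_congr_ae (Filter.Eventually.of_forall fun a =>
      integral_reward_pulledArm L B s a ν t)
  have hg (t : ℕ) : ∫ p, gap ν iStar (pulledArm L B p.1 p.2.1 p.2.2 t) ∂(jointLaw ρ α ν) =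
      mean ν iStar - ∫ p, mean ν (pulledArm L B p.1 p.2.1 p.2.2 t) ∂(jointLaw ρ α ν) := by
    simpa [gap] using integral_sub (integrable_const (mean ν iStar)) (hm t)
  have hgi (t : ℕ) : Integrable (fun p : S × A × Table K =>
      gap ν iStar (pulledArm L B p.1 p.2.1 p.2.2 t)) (jointLaw ρ α ν) :=
    (integrable_const (mean ν iStar)).sub (hm t)
  unfold regret
  rw [integral_finsetSum _ fun t _ => hr t, integral_finsetSum _ fun t _ => hgi t]
  simp [hg, he]

/-- The pulls of the arms up to round `T` weighted with a cost of each pull. -/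
theorem sum_pulledArm (L : Learner K S) (B : Attacker K A) (s : S) (a : A) (x : Table K)
    (f : Fin K → ℝ) (T : ℕ) :
    ∑ t ∈ Finset.range T, f (pulledArm L B s a x t) =
      ∑ j, ((Finset.range T).filter fun t => pulledArm L B s a x t = j).card * f j := by
  simp_rw [← nsmul_eq_mul]
  rw [← Finset.sum_fiberwise (Finset.range T) (fun t => pulledArm L B s a x t)]
  refine Finset.sum_congr rfl fun j _ => Finset.sum_eq_card_nsmul fun t ht => ?_
  rw [(Finset.mem_filter.1 ht).2]

end Regret

/-! ### Explore-then-commit follows the strategy until it stops -/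

namespace BAI

variable {S A : Type*} [MeasurableSpace S] [MeasurableSpace A]

theorem count_hist (E : BAI K S) (s : S) (x : Table K) (n : ℕ) (j : Fin K) :
    (E.hist s x n).count j =
      ((Finset.range n).filter fun t => E.sample t s (E.hist s x t) = j).card := by
  rw [Finset.card_filter]
  induction n with
  | zero => simp [Hist.count]
  | succ n ih => rw [hist, count_snoc, ih, Finset.sum_range_succ]

theorem committed_hist_eq_none (E : BAI K S) (s : S) (x : Table K) (n : ℕ)
    (h : ∀ m ≤ n, E.halt m s (E.hist s x m) = false) :
    E.committed n s (E.hist s x n) = none := by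
  induction n with
  | zero => simp [committed, h 0 le_rfl]
  | succ n ih =>
    have h1 : (Fin.init (E.hist s x (n + 1)) : Hist K n) = E.hist s x n := by
      simp [hist, Fin.init_snoc]
    simp [committed, h1, ih fun m hm => h m (hm.trans n.le_succ), h (n + 1) le_rfl]

theorem committed_hist_of_stopsAt (E : BAI K S) (s : S) (x : Table K) (n : ℕ)
    (h : E.StopsAt s x n) :
    E.committed n s (E.hist s x n) = some (E.recommend n s (E.hist s x n)) := by
  cases n with
  | zero => simp [committed, h.1]
  | succ n =>
    have h1 : (Fin.init (E.hist s x (n + 1)) : Hist K n) = E.hist s x n := by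
      simp [hist, Fin.init_snoc]
    have h2 := E.committed_hist_eq_none s x n fun m hm => h.2 m (Nat.lt_succ_of_le hm)
    simp [committed, h1, h2, h.1]

theorem exploreThenCommit_act (E : BAI K S) (n : ℕ) (s : S) (h : Hist K n) :
    E.exploreThenCommit.act n s h = (E.committed n s h).getD (E.sample n s h) := rfl

theorem exploreThenCommit_verify (E : BAI K S) (n : ℕ) (s : S) (h : Hist K n) :
    E.exploreThenCommit.verify n s h = (E.committed n s h).isNone := rfl

/-- All rounds that produce this history precede the stop, hence are verified, and the attacker's
value is never used. -/
theorem play_exploreThenCommit (E : BAI K S) (B : Attacker K A) (s : S) (a : A) (x : Table K)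
    (n : ℕ) (h : ∀ m < n, E.halt m s (E.hist s x m) = false) :
    (play E.exploreThenCommit B s a x n).2 = E.hist s x n := by
  induction n with
  | zero => rfl
  | succ n ih =>
    have h1 := ih fun m hm => h m (hm.trans n.lt_succ_self)
    have h2 := E.committed_hist_eq_none s x n fun m hm => h m (Nat.lt_succ_of_le hm)
    simp [play, hist, h1, exploreThenCommit_act, exploreThenCommit_verify, h2]

/-- The commitment is read off the shortest prefix at which the strategy stops, and that prefix is
uncorrupted. Later entries, possibly corrupted, cannot change it. -/
theorem committed_play_of_stopsAt (E : BAI K S) (B : Attacker K A) (s : S) (a : A)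
    (x : Table K) {n : ℕ} (h : E.StopsAt s x n) {t : ℕ} (ht : n ≤ t) :
    E.committed t s (play E.exploreThenCommit B s a x t).2 =
      some (E.recommend n s (E.hist s x n)) := by
  induction t, ht using Nat.le_induction with
  | base => rw [E.play_exploreThenCommit B s a x n h.2, E.committed_hist_of_stopsAt s x n h]
  | succ t _ ih =>
    have h1 : (Fin.init (play E.exploreThenCommit B s a x (t + 1)).2 : Hist K t) =
        (play E.exploreThenCommit B s a x t).2 := by
      simp only [play, Fin.init_snoc]
    simp only [committed, h1, ih]

theorem committed_play_of_lt (E : BAI K S) (B : Attacker K A) (s : S) (a : A)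
    (x : Table K) {n : ℕ} (h : E.StopsAt s x n) {t : ℕ} (ht : t < n) :
    E.committed t s (play E.exploreThenCommit B s a x t).2 = none := by
  rw [E.play_exploreThenCommit B s a x t fun m hm => h.2 m (hm.trans ht)]
  exact E.committed_hist_eq_none s x t fun m hm => h.2 m (hm.trans_lt ht)

theorem numVerified_exploreThenCommit_le (E : BAI K S) (B : Attacker K A) (s : S) (a : A)
    (x : Table K) {n : ℕ} (h : E.StopsAt s x n) (T : ℕ) :
    numVerified E.exploreThenCommit B s a x T ≤ n := by
  rw [← Finset.card_range n]
  refine Finset.card_le_card fun t ht => ?_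
  rw [Finset.mem_range]
  by_contra! hn
  simpa [exploreThenCommit_verify, E.committed_play_of_stopsAt B s a x h hn] using
    (Finset.mem_filter.1 ht).2

/-- After the stop only the recommended arm is pulled, so each pull of `j` is one of the
exploration. -/
theorem card_pulledArm_exploreThenCommit_le (E : BAI K S) (B : Attacker K A) (s : S) (a : A)
    (x : Table K) {n : ℕ} (h : E.StopsAt s x n) (T : ℕ) {j : Fin K}
    (hj : E.recommend n s (E.hist s x n) ≠ j) :
    ((Finset.range T).filter fun t => pulledArm E.exploreThenCommit B s a x t = j).card ≤
      (E.hist s x n).count j := by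
  rw [count_hist]
  refine Finset.card_le_card fun t ht => ?_
  have h2 := (Finset.mem_filter.1 ht).2
  rcases lt_or_ge t n with htn | htn
  · refine Finset.mem_filter.2 ⟨Finset.mem_range.2 htn, ?_⟩
    rw [← h2, pulledArm, exploreThenCommit_act, E.committed_play_of_lt B s a x h htn,
      Option.getD_none, E.play_exploreThenCommit B s a x t fun m hm => h.2 m (hm.trans htn)]
  · refine absurd ?_ hj
    rw [← h2, pulledArm, exploreThenCommit_act, E.committed_play_of_stopsAt B s a x h htn,
      Option.getD_some]

end BAI

/-! ### Arithmetic of the complexity -/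

theorem half_le_log {T : ℕ} (hT : 2 ≤ T) : (1 / 2 : ℝ) ≤ Real.log T := by
  have h1 : Real.log 2 ≤ Real.log T := Real.log_le_log (by norm_num) (by exact_mod_cast hT)
  have h2 := Real.log_two_gt_d9
  linarith

theorem complexity_nonneg {δ Δ : ℝ} (hK : 1 ≤ K) (hδ : 0 < δ) (hδ1 : δ ≤ 1) (hΔ : 0 < Δ)
    (hΔ1 : Δ ≤ 1) : 0 ≤ BAI.complexity K δ Δ := by
  refine div_nonneg (Real.log_nonneg ?_) (sq_nonneg _)
  rw [one_le_div (by positivity)]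
  calc δ * Δ ≤ 1 := mul_le_one₀ hδ1 hΔ.le hΔ1
    _ ≤ K := by exact_mod_cast hK

/-- Each of `K`, `1 / δ = T` and `1 / Δ` is at most `T`, which gives `log (T ^ 3)`. -/
theorem complexity_le_of_inv_le {T : ℕ} (hT : 2 ≤ T) (hK : 1 ≤ K) (hKT : K ≤ T) {Δ : ℝ}
    (hΔ : 1 ≤ Δ * T) (hΔ0 : 0 < Δ) :
    BAI.complexity K (1 / (T : ℝ)) Δ ≤ 3 * (Real.log T / Δ ^ 2) := by
  have hT0 : (0 : ℝ) < T := by positivity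
  have hK0 : (0 : ℝ) < K := by exact_mod_cast hK
  have hKT' : (K : ℝ) ≤ T := by exact_mod_cast hKT
  have h1 : (K : ℝ) / (1 / (T : ℝ) * Δ) ≤ (T : ℝ) ^ 3 := by
    rw [div_le_iff₀ (by positivity)]
    calc (K : ℝ) ≤ T * 1 := by linarith
      _ ≤ T * (Δ * T) := by gcongr
      _ = (T : ℝ) ^ 3 * (1 / (T : ℝ) * Δ) := by field_simp
  have h2 := Real.log_le_log (by positivity) h1
  rw [Real.log_pow] at h2
  unfold BAI.complexity
  rw [← mul_div_assoc]
  gcongr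
  exact_mod_cast h2

/-- A trivial bound by the horizon beats the logarithmic one if the gap is below `1 / T`. -/
theorem horizon_le_of_lt_inv {T : ℕ} (hT : 2 ≤ T) {Δ : ℝ} (hΔ : Δ * T < 1) (hΔ0 : 0 < Δ)
    (hΔ1 : Δ ≤ 1) : (T : ℝ) ≤ 2 * (Real.log T / Δ ^ 2) := by
  have hl := half_le_log hT
  rw [← mul_div_assoc, le_div_iff₀ (by positivity)]
  have h1 : (T : ℝ) * Δ ^ 2 ≤ 1 := by
    calc (T : ℝ) * Δ ^ 2 = (Δ * T) * Δ := by ring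
      _ ≤ 1 := mul_le_one₀ hΔ.le hΔ0.le hΔ1
  linarith

/-- The budget is used for gaps at least `1 / T`, the horizon for smaller ones. The absolute value
is there because `C` may have any sign. -/
theorem pulls_le {T : ℕ} (hT : 2 ≤ T) (hK : 1 ≤ K) (hKT : K ≤ T) {C Δ p : ℝ} (hΔ0 : 0 < Δ)
    (hΔ1 : Δ ≤ 1) (hp : p ≤ T) (hpC : p ≤ C * BAI.complexity K (1 / (T : ℝ)) Δ) :
    p ≤ (3 * |C| + 2) * (Real.log T / Δ ^ 2) := by
  have hl : 0 ≤ Real.log T / Δ ^ 2 :=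
    div_nonneg (by linarith [half_le_log hT]) (sq_nonneg _)
  have hC := abs_nonneg C
  rcases lt_or_ge (Δ * T) 1 with h | h
  · have := horizon_le_of_lt_inv hT h hΔ0 hΔ1
    nlinarith
  · have h1 := complexity_le_of_inv_le hT hK hKT h hΔ0
    have hT1 : (1 : ℝ) ≤ T := by exact_mod_cast (by omega : 1 ≤ T)
    have h0 := complexity_nonneg (δ := 1 / (T : ℝ)) hK (by positivity)
      (by rw [div_le_one (by positivity)]; exact hT1) hΔ0 hΔ1
    have h2 := mul_le_mul_of_nonneg_right (le_abs_self C) h0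
    have h3 := mul_le_mul_of_nonneg_left h1 hC
    nlinarith

section Sums

variable (ν : Fin K → Measure I) [∀ i, IsProbabilityMeasure (ν i)] {iStar : Fin K}

theorem log_div_gap_nonneg (hb : IsBestArm ν iStar) {T : ℕ} (hT : 2 ≤ T) (d : ℕ) {j : Fin K}
    (hj : j ≠ iStar) : (1 / 2 : ℝ) ≤ Real.log T / gap ν iStar j ^ d := by
  have h0 := hb.gap_pos hj
  have h1 : gap ν iStar j ^ d ≤ 1 := pow_le_one₀ h0.le (gap_le_one ν iStar j)
  have hl := half_le_log hT
  rw [le_div_iff₀ (by positivity)]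
  nlinarith

/-- The bounds of the theorem exceed the number of suboptimal arms, up to a constant. -/
theorem card_le_sum_log_div (hb : IsBestArm ν iStar) {T : ℕ} (hT : 2 ≤ T) (d : ℕ) :
    (K : ℝ) - 1 ≤ 2 * ∑ j ∈ Finset.univ.erase iStar, Real.log T / gap ν iStar j ^ d := by
  have h : ((Finset.univ.erase iStar).card : ℝ) * (1 / 2) ≤
      ∑ j ∈ Finset.univ.erase iStar, Real.log T / gap ν iStar j ^ d := by
    rw [← nsmul_eq_mul]
    exact Finset.card_nsmul_le_sum _ _ _ fun j hj =>
      log_div_gap_nonneg ν hb hT d (Finset.ne_of_mem_erase hj)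
  rw [Finset.card_erase_of_mem (Finset.mem_univ _), Finset.card_fin, Nat.cast_sub
    (Fin.pos iStar)] at h
  push_cast at h
  linarith

end Sums

/-! ### Regret and verifications on the good event -/

section Pathwise

variable {S A : Type*} [MeasurableSpace S] [MeasurableSpace A]

/-- The event that `E` stops within the budgets with constant `C`. -/
def BAI.stopsInBudget (E : BAI K S) (ν : Fin K → Measure I) (iStar : Fin K) (C δ : ℝ) :
    Set (S × Table K) :=
  {p | ∃ n, E.StopsAt p.1 p.2 n ∧
    (∀ j, j ≠ iStar →
      ((E.hist p.1 p.2 n).count j : ℝ) ≤ C * BAI.complexity K δ (gap ν iStar j)) ∧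
    (n : ℝ) ≤ C * ∑ j ∈ Finset.univ.erase iStar, BAI.complexity K δ (gap ν iStar j)}

/-- The event that `E` stops and recommends a wrong arm. -/
def BAI.recommendsWrong (E : BAI K S) (iStar : Fin K) : Set (S × Table K) :=
  {p | ∃ n, E.StopsAt p.1 p.2 n ∧ E.recommend n p.1 (E.hist p.1 p.2 n) ≠ iStar}

theorem BAI.measurableSet_stopsInBudget (E : BAI K S) (ν : Fin K → Measure I) (iStar : Fin K)
    (C δ : ℝ) : MeasurableSet (E.stopsInBudget ν iStar C δ) := by
  have h : E.stopsInBudget ν iStar C δ = ⋃ n, {p | E.StopsAt p.1 p.2 n} ∩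
      ((⋂ j, ⋂ (_ : j ≠ iStar), {p | ((E.hist p.1 p.2 n).count j : ℝ) ≤
        C * BAI.complexity K δ (gap ν iStar j)}) ∩
      {_p | (n : ℝ) ≤ C * ∑ j ∈ Finset.univ.erase iStar,
        BAI.complexity K δ (gap ν iStar j)}) := by
    ext p
    simp [BAI.stopsInBudget]
  rw [h]
  refine MeasurableSet.iUnion fun n => (E.measurableSet_stopsAt n).inter
    ((MeasurableSet.iInter fun j => MeasurableSet.iInter fun _ => ?_).inter
      (MeasurableSet.const _))
  exact ((measurable_count j).comp (E.measurable_hist n))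
    (MeasurableSet.of_discrete (s := {c : ℕ | (c : ℝ) ≤ _}))

theorem BAI.measurableSet_recommendsWrong (E : BAI K S) (iStar : Fin K) :
    MeasurableSet (E.recommendsWrong iStar) := by
  have h : E.recommendsWrong iStar = ⋃ n, {p | E.StopsAt p.1 p.2 n} ∩
      {p | E.recommend n p.1 (E.hist p.1 p.2 n) = iStar}ᶜ := by
    ext p
    simp [BAI.recommendsWrong]
  rw [h]
  refine MeasurableSet.iUnion fun n => (E.measurableSet_stopsAt n).inter
    (MeasurableSet.compl ?_)
  exact ((E.measurable_recommend n).comp (measurable_fst.prodMk (E.measurable_hist n)))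
    (measurableSet_singleton iStar)

variable (E : BAI K S) (B : Attacker K A) (ν : Fin K → Measure I)
  [∀ i, IsProbabilityMeasure (ν i)] {iStar : Fin K} (s : S) (a : A) (x : Table K) {T : ℕ}
  {C : ℝ}

theorem sum_gap_le_horizon (L : Learner K S) :
    ∑ t ∈ Finset.range T, gap ν iStar (pulledArm L B s a x t) ≤ T := by
  have h := Finset.sum_le_card_nsmul (Finset.range T)
    (fun t => gap ν iStar (pulledArm L B s a x t)) 1 fun t _ => gap_le_one ν _ _
  simpa using h

theorem numVerified_le_horizon (L : Learner K S) : numVerified L B s a x T ≤ T := by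
  simpa [numVerified] using Finset.card_filter_le (Finset.range T)
    fun t => L.verify t s (play L B s a x t).2 = true

theorem sum_gap_le (hK : 2 ≤ K) (hT : 2 ≤ T) (hb : IsBestArm ν iStar)
    (hbudget : (s, x) ∈ E.stopsInBudget ν iStar C (1 / (T : ℝ)))
    (hrec : (s, x) ∉ E.recommendsWrong iStar) :
    ∑ t ∈ Finset.range T, gap ν iStar (pulledArm E.exploreThenCommit B s a x t) ≤
      (3 * |C| + 2) * ∑ j ∈ Finset.univ.erase iStar, Real.log T / gap ν iStar j ^ 1 := by
  have hC := abs_nonneg C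
  have hcard := card_le_sum_log_div ν hb hT 1
  -- With more arms than rounds, `log K` is not controlled by `log T`, but then `T ≤ K - 1`, which
  -- is at most twice the sum.
  rcases lt_or_ge T K with hTK | hKT
  · have h1 := sum_gap_le_horizon (T := T) (iStar := iStar) B ν s a x E.exploreThenCommit
    have h2 : (T : ℝ) + 1 ≤ K := by exact_mod_cast hTK
    have h3 : (1 : ℝ) ≤ K := by exact_mod_cast (by omega : 1 ≤ K)
    nlinarith
  obtain ⟨n, hn, hcount, -⟩ := hbudget
  have hrec' : E.recommend n s (E.hist s x n) = iStar := by
    by_contra h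
    exact hrec ⟨n, hn, h⟩
  rw [sum_pulledArm, ← Finset.add_sum_erase _ _ (Finset.mem_univ iStar), gap_self, mul_zero,
    zero_add, Finset.mul_sum]
  refine Finset.sum_le_sum fun j hj => ?_
  have hj' := Finset.ne_of_mem_erase hj
  have h0 := hb.gap_pos hj'
  have h1 := E.card_pulledArm_exploreThenCommit_le B s a x hn T (j := j)
    (by rw [hrec']; exact hj'.symm)
  have h2 : ((Finset.range T).filter fun t =>
      pulledArm E.exploreThenCommit B s a x t = j).card ≤ T := by
    simpa using Finset.card_filter_le (Finset.range T) _
  have h3 := pulls_le hT (by omega) hKT h0 (gap_le_one ν _ _) (Nat.cast_le.2 h2)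
    ((Nat.cast_le.2 h1).trans (hcount j hj'))
  -- The cost of a pull cancels one of the two powers of the gap.
  calc _ ≤ (3 * |C| + 2) * (Real.log T / gap ν iStar j ^ 2) * gap ν iStar j :=
        mul_le_mul_of_nonneg_right h3 h0.le
    _ = _ := by field_simp

theorem numVerified_le (hK : 2 ≤ K) (hT : 2 ≤ T) (hb : IsBestArm ν iStar)
    (hbudget : (s, x) ∈ E.stopsInBudget ν iStar C (1 / (T : ℝ))) :
    (numVerified E.exploreThenCommit B s a x T : ℝ) ≤
      (3 * |C| + 2) * ∑ j ∈ Finset.univ.erase iStar, Real.log T / gap ν iStar j ^ 2 := by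
  have hC := abs_nonneg C
  have hcard := card_le_sum_log_div ν hb hT 2
  have h1 : (numVerified E.exploreThenCommit B s a x T : ℝ) ≤ T := by
    exact_mod_cast numVerified_le_horizon B s a x E.exploreThenCommit
  have h3 : (1 : ℝ) ≤ K := by exact_mod_cast (by omega : 1 ≤ K)
  rcases lt_or_ge T K with hTK | hKT
  · have h2 : (T : ℝ) + 1 ≤ K := by exact_mod_cast hTK
    nlinarith
  have hnn (j) (hj : j ∈ Finset.univ.erase iStar) : 0 ≤ Real.log T / gap ν iStar j ^ 2 :=
    le_trans (by norm_num) (log_div_gap_nonneg ν hb hT 2 (Finset.ne_of_mem_erase hj))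
  -- A single gap below `1 / T` contributes a term that already dominates the horizon. Otherwise
  -- every summand of the total budget can be converted to `log T`.
  by_cases hsmall : ∃ j, j ≠ iStar ∧ gap ν iStar j * T < 1
  · obtain ⟨j, hj, hjT⟩ := hsmall
    have h4 := horizon_le_of_lt_inv hT hjT (hb.gap_pos hj) (gap_le_one ν _ _)
    have h5 := Finset.single_le_sum hnn (Finset.mem_erase.2 ⟨hj, Finset.mem_univ j⟩)
    nlinarith
  push Not at hsmall
  obtain ⟨n, hn, -, hnC⟩ := hbudget
  have h4 : (numVerified E.exploreThenCommit B s a x T : ℝ) ≤ n := by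
    exact_mod_cast E.numVerified_exploreThenCommit_le B s a x hn T
  have h5 : ∑ j ∈ Finset.univ.erase iStar, BAI.complexity K (1 / (T : ℝ)) (gap ν iStar j) ≤
      3 * ∑ j ∈ Finset.univ.erase iStar, Real.log T / gap ν iStar j ^ 2 := by
    rw [Finset.mul_sum]
    refine Finset.sum_le_sum fun j hj => ?_
    have hj' := Finset.ne_of_mem_erase hj
    exact complexity_le_of_inv_le hT (by omega) hKT (hsmall j hj') (hb.gap_pos hj')
  have hT1 : (1 : ℝ) ≤ T := by exact_mod_cast (by omega : 1 ≤ T)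
  have h6 : 0 ≤ ∑ j ∈ Finset.univ.erase iStar,
      BAI.complexity K (1 / (T : ℝ)) (gap ν iStar j) := by
    refine Finset.sum_nonneg fun j hj => ?_
    exact complexity_nonneg (by omega) (by positivity)
      (by rw [div_le_one (by positivity)]; exact hT1) (hb.gap_pos (Finset.ne_of_mem_erase hj))
      (gap_le_one ν _ _)
  have h7 := mul_le_mul_of_nonneg_right (le_abs_self C) h6
  have h8 := mul_le_mul_of_nonneg_left h5 hC
  nlinarith

end Pathwise

/-! ### The bad event -/

/-- A random variable with values in `[0, T]` that is at most `b` outside an event of probability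
at most `2 / T` has expectation at most `b + 2`. -/
theorem integral_le_add_two {Ω : Type*} [MeasurableSpace Ω] (P : Measure Ω)
    [IsProbabilityMeasure P] {f : Ω → ℝ} {T b : ℝ} (hT : 0 < T) (hb : 0 ≤ b) {N : Set Ω}
    (hN : MeasurableSet N) (hPN : P N ≤ ENNReal.ofReal (2 / T)) (hf : Measurable f)
    (hf0 : ∀ ω, 0 ≤ f ω) (hfT : ∀ ω, f ω ≤ T) (hfb : ∀ ω, ω ∉ N → f ω ≤ b) :
    ∫ ω, f ω ∂P ≤ b + 2 := by
  have hint : Integrable f P := Integrable.of_bound hf.aestronglyMeasurable T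
    (Filter.Eventually.of_forall fun ω => by
      rw [Real.norm_of_nonneg (hf0 ω)]; exact hfT ω)
  have hind : Integrable (N.indicator fun _ => T) P := (integrable_const T).indicator hN
  calc ∫ ω, f ω ∂P ≤ ∫ ω, (b + N.indicator (fun _ => T) ω) ∂P := by
        refine integral_mono hint ((integrable_const b).add hind) fun ω => ?_
        by_cases h : ω ∈ N
        · simp only [Set.indicator_of_mem h]
          linarith [hfT ω]
        · simp only [Set.indicator_of_notMem h]
          linarith [hfb ω h]
    _ = b + P.real N * T := by
        rw [integral_add (integrable_const b) hind, integral_indicator_const _ hN]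
        simp
    _ ≤ b + 2 := by
        have h : P.real N ≤ 2 / T := ENNReal.toReal_le_of_le_ofReal (by positivity) hPN
        have := mul_le_mul_of_nonneg_right h hT.le
        rw [div_mul_cancel₀ _ hT.ne'] at this
        linarith

/-- The additive `2` from the bad event is absorbed because each sum is at least `1 / 2`: this turns
`3 * |C| + 2` into `3 * |C| + 6`. -/
theorem exploreThenCommit_bounds {S A : Type*} [MeasurableSpace S] [MeasurableSpace A]
    (ρ : Measure S) [IsProbabilityMeasure ρ] (α : Measure A) [IsProbabilityMeasure α] {T : ℕ}
    {C : ℝ} (hK : 2 ≤ K) (hT : 2 ≤ T) (E : BAI K S)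
    (hE : E.IsFixedConfidence ρ C (1 / (T : ℝ))) (B : Attacker K A)
    (ν : Fin K → Measure I) [∀ i, IsProbabilityMeasure (ν i)] {iStar : Fin K}
    (hb : IsBestArm ν iStar) :
    regret E.exploreThenCommit B ρ α ν iStar T ≤
        (3 * |C| + 6) * ∑ j ∈ Finset.univ.erase iStar, Real.log T / gap ν iStar j ^ 1 ∧
      expectedVerifications E.exploreThenCommit B ρ α ν T ≤
        (3 * |C| + 6) * ∑ j ∈ Finset.univ.erase iStar, Real.log T / gap ν iStar j ^ 2 := by
  have hP : IsProbabilityMeasure (jointLaw ρ α ν) := by unfold jointLaw; infer_instance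
  have hT0 : (0 : ℝ) < T := by positivity
  have hT1 : (1 : ℝ) ≤ T := by exact_mod_cast (by omega : 1 ≤ T)
  have hδ : 0 ≤ 1 / (T : ℝ) := by positivity
  have hδ1 : 1 / (T : ℝ) ≤ 1 := by rw [div_le_one hT0]; exact hT1
  have hC := abs_nonneg C
  let G := E.stopsInBudget ν iStar C (1 / (T : ℝ))
  let W := E.recommendsWrong iStar
  have hG : MeasurableSet G := E.measurableSet_stopsInBudget ν iStar C _
  have hW : MeasurableSet W := E.measurableSet_recommendsWrong iStar
  have hbad : (ρ.prod (tableLaw ν)) (Gᶜ ∪ W) ≤ ENNReal.ofReal (2 / T) := by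
    have h1 : (ρ.prod (tableLaw ν)) Gᶜ ≤ ENNReal.ofReal (1 / (T : ℝ)) := by
      rw [prob_compl_eq_one_sub hG]
      calc 1 - (ρ.prod (tableLaw ν)) G ≤ 1 - ENNReal.ofReal (1 - 1 / (T : ℝ)) :=
            tsub_le_tsub_left (hE.sample_complexity ν iStar hb) 1
        _ = ENNReal.ofReal (1 / (T : ℝ)) := by
            rw [← ENNReal.ofReal_one, ← ENNReal.ofReal_sub _ (by linarith), sub_sub_cancel]
    calc _ ≤ ENNReal.ofReal (1 / (T : ℝ)) + ENNReal.ofReal (1 / (T : ℝ)) :=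
          (measure_union_le _ _).trans (add_le_add h1 (hE.correct ν iStar hb))
      _ = ENNReal.ofReal (2 / T) := by
          rw [← ENNReal.ofReal_add hδ hδ, ← add_div]
          norm_num
  -- The bad event does not involve the attacker's seed, so its probability is that in the
  -- environment without attacks.
  have hproj : MeasurePreserving (fun p : S × A × Table K => (p.1, p.2.2)) (jointLaw ρ α ν)
      (ρ.prod (tableLaw ν)) :=
    (MeasurePreserving.id ρ).prod measurePreserving_snd
  have hN := hproj.measurable (hG.compl.union hW)
  have hPN := hbad
  rw [← hproj.measure_preimage (hG.compl.union hW).nullMeasurableSet] at hPN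
  have hgood (p : S × A × Table K)
      (hp : p ∉ (fun p : S × A × Table K => (p.1, p.2.2)) ⁻¹' (Gᶜ ∪ W)) :
      (p.1, p.2.2) ∈ G ∧ (p.1, p.2.2) ∉ W := by
    simpa using hp
  have hsum (d : ℕ) : (1 / 2 : ℝ) ≤
      ∑ j ∈ Finset.univ.erase iStar, Real.log T / gap ν iStar j ^ d := by
    have h1 := card_le_sum_log_div ν hb hT d
    have h2 : (2 : ℝ) ≤ K := by exact_mod_cast hK
    linarith
  constructor
  · have h := integral_le_add_two (jointLaw ρ α ν) (T := T)
      (f := fun p => ∑ t ∈ Finset.range T,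
        gap ν iStar (pulledArm E.exploreThenCommit B p.1 p.2.1 p.2.2 t))
      hT0 (mul_nonneg (by linarith) (by linarith [hsum 1])) hN hPN
      (Finset.measurable_sum _ fun t _ => measurable_gap_pulledArm _ B _ t)
      (fun p => Finset.sum_nonneg fun t _ => by
        by_cases hj : pulledArm E.exploreThenCommit B p.1 p.2.1 p.2.2 t = iStar
        · rw [hj, gap_self]
        · exact (hb.gap_pos hj).le)
      (fun p => sum_gap_le_horizon B ν p.1 p.2.1 p.2.2 _)
      (fun p hp => sum_gap_le E B ν p.1 p.2.1 p.2.2 hK hT hb (hgood p hp).1 (hgood p hp).2)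
    rw [← regret_eq_integral_gap] at h
    linarith [hsum 1]
  · have hv (t : ℕ) : Measurable fun p : S × A × Table K =>
        E.exploreThenCommit.verify t p.1 (play E.exploreThenCommit B p.1 p.2.1 p.2.2 t).2 :=
      (E.exploreThenCommit.measurable_verify t).comp
        (measurable_fst.prodMk (measurable_play E.exploreThenCommit B t).snd)
    have h := integral_le_add_two (jointLaw ρ α ν) (T := T)
      (f := fun p => (numVerified E.exploreThenCommit B p.1 p.2.1 p.2.2 T : ℝ))
      hT0 (mul_nonneg (by linarith) (by linarith [hsum 2])) hN hPN
      (by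
        simp only [numVerified, Finset.card_filter]
        push_cast
        exact Finset.measurable_sum _ fun t _ => Measurable.ite
          (hv t (measurableSet_singleton true)) measurable_const measurable_const)
      (fun p => Nat.cast_nonneg _)
      (fun p => Nat.cast_le.2 (numVerified_le_horizon B p.1 p.2.1 p.2.2 _))
      (fun p hp => numVerified_le E B ν p.1 p.2.1 p.2.2 hK hT hb (hgood p hp).1)
    unfold expectedVerifications
    linarith [hsum 2]

/-! ### Concentration of the rewards of an arm along the pulls of a strategy -/

/-- The sum of the rewards of arm `i` in a history. -/
noncomputable def Hist.rewardSum {n : ℕ} (h : Hist K n) (i : Fin K) : ℝ :=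
  ∑ k, if (h k).1 = i then ((h k).2 : ℝ) else 0

theorem rewardSum_snoc {n : ℕ} (h : Hist K n) (q : Fin K × I) (i : Fin K) :
    Hist.rewardSum (Fin.snoc h q : Hist K (n + 1)) i =
      h.rewardSum i + if q.1 = i then (q.2 : ℝ) else 0 := by
  simp only [Hist.rewardSum, Fin.sum_univ_castSucc, Fin.snoc_castSucc, Fin.snoc_last]

theorem measurable_rewardSum {n : ℕ} (i : Fin K) :
    Measurable fun h : Hist K n => h.rewardSum i := by
  refine Finset.measurable_sum _ fun k _ => Measurable.ite ?_ ?_ measurable_const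
  · exact (measurable_fst.comp (measurable_pi_apply k)) (measurableSet_singleton i)
  · exact measurable_subtype_coe.comp (measurable_snd.comp (measurable_pi_apply k))

/-- Hoeffding's lemma for a law on the unit interval. -/
theorem integral_exp_le_one (ν : Fin K → Measure I) [∀ i, IsProbabilityMeasure (ν i)]
    (i : Fin K) (l : ℝ) :
    ∫ r, Real.exp (l * ((r : ℝ) - mean ν i) - l ^ 2 / 8) ∂(ν i) ≤ 1 := by
  have h := (hasSubgaussianMGF_of_mem_Icc (μ := ν i) (X := fun r : I => (r : ℝ)) (a := 0)
    (b := 1) measurable_subtype_coe.aemeasurable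
    (Filter.Eventually.of_forall fun r => r.2)).mgf_le l
  simp_rw [sub_eq_add_neg _ (l ^ 2 / 8), Real.exp_add]
  rw [integral_mul_const, Real.exp_neg, ← div_eq_mul_inv, div_le_one (Real.exp_pos _)]
  refine h.trans (Real.exp_le_exp.2 (le_of_eq ?_))
  simp
  ring

namespace BAI

variable {S : Type*} [MeasurableSpace S] (E : BAI K S) (s : S)

/-- The sum of the deviations of the first `m` rewards of arm `i` from `μ`. -/
noncomputable def cappedDev (i : Fin K) (m : ℕ) (μ : ℝ) (x : Table K) : ℕ → ℝ
  | 0 => 0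
  | n + 1 => cappedDev i m μ x n +
      if E.sample n s (E.hist s x n) = i ∧ (E.hist s x n).count i < m then (x n i : ℝ) - μ else 0

/-- Until the cap is exceeded no reward of the arm has been dropped. -/
theorem cappedDev_eq (i : Fin K) (m : ℕ) (μ : ℝ) (x : Table K) (n : ℕ)
    (h : (E.hist s x n).count i ≤ m) :
    E.cappedDev s i m μ x n =
      (E.hist s x n).rewardSum i - (E.hist s x n).count i * μ := by
  induction n with
  | zero => simp [cappedDev, Hist.rewardSum, Hist.count]
  | succ n ih =>
    rw [hist, count_snoc] at h
    rw [cappedDev, hist, count_snoc, rewardSum_snoc, ih ((Nat.le_add_right _ _).trans h)]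
    by_cases hi : E.sample n s (E.hist s x n) = i
    · simp only [hi, if_true] at h
      rw [if_pos ⟨hi, h⟩, if_pos hi, if_pos hi, hi]
      push_cast
      ring
    · rw [if_neg (fun h => hi h.1), if_neg hi, if_neg hi]
      simp

theorem abs_cappedDev_le (i : Fin K) (m : ℕ) {μ : ℝ} (h0 : 0 ≤ μ) (h1 : μ ≤ 1) (x : Table K)
    (n : ℕ) : |E.cappedDev s i m μ x n| ≤ n := by
  induction n with
  | zero => simp [cappedDev]
  | succ n ih =>
    rw [cappedDev]
    have h2 := (x n i).2.1
    have h3 := (x n i).2.2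
    rw [abs_le] at ih ⊢
    push_cast
    split_ifs <;> constructor <;> linarith

/-- The exponential supermartingale of the capped deviations. -/
noncomputable def expDev (i : Fin K) (m : ℕ) (μ l : ℝ) (n : ℕ) (x : Table K) : ℝ :=
  Real.exp (l * E.cappedDev s i m μ x n - l ^ 2 / 8 * (min ((E.hist s x n).count i) m : ℕ))

theorem measurable_hist_right (n : ℕ) : Measurable fun x : Table K => E.hist s x n :=
  (E.measurable_hist n).comp (measurable_const.prodMk measurable_id)

theorem measurable_sample_hist (n : ℕ) :
    Measurable fun x : Table K => E.sample n s (E.hist s x n) :=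
  (E.measurable_sample n).comp (measurable_const.prodMk (E.measurable_hist_right s n))

theorem measurable_count_hist (i : Fin K) (n : ℕ) :
    Measurable fun x : Table K => (E.hist s x n).count i :=
  (measurable_count i).comp (E.measurable_hist_right s n)

theorem measurableSet_pulls (i : Fin K) (m n : ℕ) : MeasurableSet {x : Table K |
    E.sample n s (E.hist s x n) = i ∧ (E.hist s x n).count i < m} :=
  (E.measurable_sample_hist s n (measurableSet_singleton i)).inter
    (E.measurable_count_hist s i n (MeasurableSet.of_discrete (s := {c : ℕ | c < m})))

theorem measurable_cappedDev (i : Fin K) (m : ℕ) (μ : ℝ) (n : ℕ) :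
    Measurable fun x => E.cappedDev s i m μ x n := by
  induction n with
  | zero => exact measurable_const
  | succ n ih =>
    refine ih.add (Measurable.ite (E.measurableSet_pulls s i m n) ?_ measurable_const)
    exact (measurable_subtype_coe.comp ((measurable_pi_apply i).comp measurable_round)).sub_const μ

theorem dependsOn_cappedDev (i : Fin K) (m : ℕ) (μ : ℝ) (n : ℕ) :
    DependsOn (fun x => E.cappedDev s i m μ x n) (Set.Iio n) := by
  induction n with
  | zero => intro x y _; rfl
  | succ n ih =>
    intro x y hxy
    have h0 : ∀ t ∈ Set.Iio n, x t = y t := fun t (ht : t < n) => hxy t (ht.trans n.lt_succ_self)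
    have h1 := ih h0
    have h2 := E.dependsOn_hist s n h0
    have h3 : x n = y n := hxy n n.lt_succ_self
    simp only at h1 h2
    simp only [cappedDev, h1, h2, h3]

variable (i : Fin K) (m : ℕ) (μ l : ℝ) (n : ℕ)

theorem measurable_expDev : Measurable (E.expDev s i m μ l n) := by
  have h := E.measurable_count_hist s i n
  exact Real.measurable_exp.comp (((E.measurable_cappedDev s i m μ n).const_mul l).sub
    (((measurable_of_countable fun c : ℕ => ((min c m : ℕ) : ℝ)).comp h).const_mul _))

theorem dependsOn_expDev : DependsOn (E.expDev s i m μ l n) (Set.Iio n) := by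
  intro x y hxy
  have h1 := E.dependsOn_cappedDev s i m μ n hxy
  have h2 := E.dependsOn_hist s n hxy
  simp only at h1 h2
  simp only [expDev, h1, h2]

theorem expDev_succ (x : Table K) :
    E.expDev s i m μ l (n + 1) x = E.expDev s i m μ l n x *
      if E.sample n s (E.hist s x n) = i ∧ (E.hist s x n).count i < m
        then Real.exp (l * ((x n i : ℝ) - μ) - l ^ 2 / 8) else 1 := by
  rw [expDev, expDev, cappedDev, hist, count_snoc]
  by_cases hi : E.sample n s (E.hist s x n) = i
  · by_cases hm : (E.hist s x n).count i < m
    · have hp := And.intro hi hm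
      rw [if_pos hp, if_pos hp, if_pos hi, min_eq_left hm.le, min_eq_left (by omega),
        ← Real.exp_add]
      congr 1
      push_cast
      ring
    · have hp : ¬ (E.sample n s (E.hist s x n) = i ∧ (E.hist s x n).count i < m) :=
        fun h => hm h.2
      rw [if_neg hp, if_neg hp, if_pos hi, min_eq_right (not_lt.1 hm),
        min_eq_right (by omega), add_zero, mul_one]
  · have hp : ¬ (E.sample n s (E.hist s x n) = i ∧ (E.hist s x n).count i < m) :=
      fun h => hi h.1
    rw [if_neg hp, if_neg hp, if_neg hi, add_zero, add_zero, mul_one]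

variable {μ} (ν : Fin K → Measure I) [∀ i, IsProbabilityMeasure (ν i)]

theorem integrable_expDev (h0 : 0 ≤ μ) (h1 : μ ≤ 1) :
    Integrable (E.expDev s i m μ l n) (tableLaw ν) := by
  refine Integrable.of_bound (E.measurable_expDev s i m μ l n).aestronglyMeasurable
    (Real.exp (|l| * n)) (Filter.Eventually.of_forall fun x => ?_)
  rw [expDev, Real.norm_eq_abs, Real.abs_exp, Real.exp_le_exp]
  have h2 : l * E.cappedDev s i m μ x n ≤ |l| * n :=
    (le_abs_self _).trans (by
      rw [abs_mul]
      exact mul_le_mul_of_nonneg_left (E.abs_cappedDev_le s i m h0 h1 x n) (abs_nonneg l))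
  have h3 : 0 ≤ l ^ 2 / 8 * (min ((E.hist s x n).count i) m : ℕ) := by positivity
  linarith

/-- Whether round `n` contributes is decided by the past. If it does, the new factor has mean at
most `1` by Hoeffding's lemma; if not, it equals `1`. -/
theorem integral_expDev_le_one :
    ∫ x, E.expDev s i m (mean ν i) l n x ∂(tableLaw ν) ≤ 1 := by
  induction n with
  | zero => simp [expDev, cappedDev, Hist.count]
  | succ n ih =>
    refine le_trans ?_ ih
    let f : Table K → ℝ := fun x =>
      if E.sample n s (E.hist s x n) = i ∧ (E.hist s x n).count i < m then 1 else 0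
    let W := E.expDev s i m (mean ν i) l n
    let φ : I → ℝ := fun r => Real.exp (l * ((r : ℝ) - mean ν i) - l ^ 2 / 8)
    have hf : Measurable f :=
      Measurable.ite (E.measurableSet_pulls s i m n) measurable_const measurable_const
    have hfd : DependsOn f (Set.Iio n) := by
      intro x y hxy
      have h2 := E.dependsOn_hist s n hxy
      simp only at h2
      simp only [f, h2]
    have hφ : Measurable φ := by fun_prop
    have hW : Integrable W (tableLaw ν) :=
      E.integrable_expDev s i m l n ν (mean_nonneg ν i) (mean_le_one ν i)
    have hWf : Integrable (fun x => W x * f x) (tableLaw ν) := by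
      refine hW.mono ((E.measurable_expDev s i m _ l n).mul hf).aestronglyMeasurable
        (Filter.Eventually.of_forall fun x => ?_)
      simp only [f]
      split_ifs <;> simp
    -- With `f` the indicator of a contributing round, only the part `W * f` meets the fresh reward.
    have hsplit (x : Table K) : E.expDev s i m (mean ν i) l (n + 1) x =
        (W x - W x * f x) + W x * f x * φ (x n i) := by
      rw [expDev_succ]
      simp only [f, W, φ]
      split_ifs <;> ring
    have hWfφ : Integrable (fun x => W x * f x * φ (x n i)) (tableLaw ν) := by
      have h := (E.integrable_expDev s i m l (n + 1) ν (mean_nonneg ν i)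
        (mean_le_one ν i)).sub (hW.sub hWf)
      refine h.congr (Filter.Eventually.of_forall fun x => ?_)
      simp only [Pi.sub_apply, hsplit]
      ring
    have hWfm : Measurable fun x => W x * f x := (E.measurable_expDev s i m _ l n).mul hf
    have hWfd : DependsOn (fun x => W x * f x) (Set.Iio n) := by
      intro x y hxy
      simp only [hfd hxy, W, E.dependsOn_expDev s i m _ l n hxy]
    have hnn : 0 ≤ ∫ x, W x * f x ∂(tableLaw ν) := by
      refine integral_nonneg fun x => mul_nonneg (Real.exp_pos _).le ?_
      simp only [f]
      split_ifs <;> norm_num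
    have hWs : Integrable (fun x => W x - W x * f x) (tableLaw ν) := hW.sub hWf
    simp_rw [hsplit]
    rw [integral_add hWs hWfφ, integral_sub hW hWf,
      integral_mul_reward ν hWfm hWfd hφ i]
    have h1 := mul_le_mul_of_nonneg_left (integral_exp_le_one ν i l) hnn
    linarith

theorem count_hist_mono (x : Table K) : Monotone fun n => (E.hist s x n).count i :=
  monotone_nat_of_le_succ fun n => by
    simp only [hist, count_snoc]
    exact Nat.le_add_right _ _

/-- A Chernoff bound for the sum of the first `m` rewards of arm `i`, whenever they are pulled. -/
theorem measure_exists_dev_le (c : ℝ) :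
    tableLaw ν {x | ∃ n, (E.hist s x n).count i = m ∧
      c ≤ l * ((E.hist s x n).rewardSum i - m * mean ν i)} ≤
    ENNReal.ofReal (Real.exp (l ^ 2 / 8 * m - c)) := by
  -- After `m` pulls the capped deviation is frozen, so these events increase with `n`. Continuity
  -- from below then replaces a union bound over time.
  let A : ℕ → Set (Table K) := fun n =>
    {x | m ≤ (E.hist s x n).count i ∧ c ≤ l * E.cappedDev s i m (mean ν i) x n}
  have hsub : {x | ∃ n, (E.hist s x n).count i = m ∧
      c ≤ l * ((E.hist s x n).rewardSum i - m * mean ν i)} ⊆ ⋃ n, A n := by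
    rintro x ⟨n, hn, hc⟩
    refine Set.mem_iUnion.2 ⟨n, hn.ge, ?_⟩
    rw [E.cappedDev_eq s i m _ x n hn.le, hn]
    exact hc
  have hmono : Monotone A := by
    refine monotone_nat_of_le_succ fun n x hx => ?_
    refine ⟨hx.1.trans (E.count_hist_mono s i x n.le_succ), ?_⟩
    rw [cappedDev, if_neg fun h => absurd hx.1 (not_le.2 h.2), add_zero]
    exact hx.2
  refine (measure_mono hsub).trans ?_
  rw [hmono.measure_iUnion]
  refine iSup_le fun n => ?_
  -- On `A n` the compensator is exactly `l ^ 2 / 8 * m`, so Markov's inequality applies to the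
  -- supermartingale.
  have hAn : A n ⊆ {x | Real.exp (c - l ^ 2 / 8 * m) ≤ E.expDev s i m (mean ν i) l n x} := by
    intro x hx
    refine Real.exp_le_exp.2 ?_
    rw [min_eq_right hx.1]
    linarith [hx.2]
  refine (measure_mono hAn).trans ?_
  have hmk := mul_meas_ge_le_integral_of_nonneg (μ := tableLaw ν)
    (Filter.Eventually.of_forall fun x => (Real.exp_pos _).le)
    (E.integrable_expDev s i m l n ν (mean_nonneg ν i) (mean_le_one ν i))
    (Real.exp (c - l ^ 2 / 8 * m))
  rw [← ofReal_measureReal]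
  refine ENNReal.ofReal_le_ofReal ?_
  rw [show l ^ 2 / 8 * m - c = -(c - l ^ 2 / 8 * m) by ring, Real.exp_neg, ← one_div,
    le_div_iff₀' (Real.exp_pos _)]
  exact hmk.trans (E.integral_expDev_le_one s i m l n ν)

end BAI

/-! ### Confidence radii -/

/-- The confidence radius after `m` pulls of an arm. -/
noncomputable def radius (a : ℝ) (m : ℕ) : ℝ :=
  √(2 * (Real.log (a * (m + 1)) / (m + 1)))

theorem radius_nonneg (a : ℝ) (m : ℕ) : 0 ≤ radius a m := Real.sqrt_nonneg _

theorem radius_sq {a : ℝ} (ha : 1 ≤ a) (m : ℕ) :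
    radius a m ^ 2 = 2 * (Real.log (a * (m + 1)) / (m + 1)) := by
  have h1 : 1 ≤ a * (m + 1) := by nlinarith [Nat.cast_nonneg (α := ℝ) m]
  exact Real.sq_sqrt (mul_nonneg zero_le_two (div_nonneg (Real.log_nonneg h1) (by positivity)))

/-- The map `u ↦ log u / u` decreases on `u ≥ e`, used at `u = a * (m + 1)`. Hence a least pulled
candidate has the largest radius. -/
theorem radius_antitone {a : ℝ} (ha : Real.exp 1 ≤ a) : Antitone (radius a) := by
  intro m n hmn
  have ha0 : 0 < a := (Real.exp_pos 1).trans_le ha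
  have hmn' : (m : ℝ) + 1 ≤ n + 1 := by gcongr
  have h1 : a ≤ a * (m + 1) := le_mul_of_one_le_right ha0.le (by simp)
  have h2 : a * (m + 1) ≤ a * (n + 1) := mul_le_mul_of_nonneg_left hmn' ha0.le
  have h := Real.log_div_self_antitoneOn (Set.mem_Ici.2 (ha.trans h1))
    (Set.mem_Ici.2 (ha.trans (h1.trans h2))) h2
  have h3 := mul_le_mul_of_nonneg_left h ha0.le
  have e (k : ℕ) : a * (Real.log (a * (k + 1)) / (a * (k + 1))) =
      Real.log (a * (k + 1)) / (k + 1) := by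
    field_simp
  simp only [e] at h3
  exact Real.sqrt_le_sqrt (by linarith)

/-- An arm without pulls has empirical mean `0 / 0 = 0`, so a radius of at least `1` makes its
interval valid. -/
theorem one_le_radius_zero {a : ℝ} (ha : Real.exp 1 ≤ a) : 1 ≤ radius a 0 := by
  have h := (Real.le_log_iff_exp_le ((Real.exp_pos 1).trans_le ha)).2 ha
  unfold radius
  rw [Real.one_le_sqrt]
  norm_num
  linarith

/-- An arm that is not yet separated at radius `radius (2 K / δ) m` has few pulls. -/
theorem succ_le_complexity {δ Δ : ℝ} (hK : 2 ≤ K) (hδ : 0 < δ) (hδ1 : δ ≤ 1) (hΔ : 0 < Δ)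
    (hΔ1 : Δ ≤ 1) {m : ℕ} (h : Δ ≤ 4 * radius (2 * K / δ) m) :
    (m : ℝ) + 1 ≤ 576 * BAI.complexity K δ Δ := by
  have hK2 : (2 : ℝ) ≤ K := by exact_mod_cast hK
  have hm : (0 : ℝ) < m + 1 := by positivity
  have ha : 1 ≤ 2 * K / δ := by rw [le_div_iff₀ hδ]; linarith
  have h1 : Δ ^ 2 ≤ 16 * (2 * (Real.log (2 * K / δ * (m + 1)) / (m + 1))) := by
    rw [← radius_sq ha, show (16 : ℝ) * radius (2 * K / δ) m ^ 2 =
      (4 * radius (2 * K / δ) m) ^ 2 by ring]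
    exact pow_le_pow_left₀ hΔ.le h 2
  have h2 : (m + 1) * Δ ^ 2 ≤ 32 * Real.log (2 * K / δ * (m + 1)) := by
    have := mul_le_mul_of_nonneg_left h1 hm.le
    calc _ ≤ _ := this
      _ = _ := by field_simp; ring
  -- This is `log y ≤ y - 1` at `y = (m + 1) * Δ ^ 2 / 64`. The factor `64` lets `32 * y` be
  -- absorbed in half of the left side of `h2`.
  have h3 : Real.log (2 * K / δ * (m + 1)) ≤
      Real.log (2 * K / δ * (64 / Δ ^ 2)) + (m + 1) * Δ ^ 2 / 64 := by
    have e : 2 * K / δ * ((m : ℝ) + 1) =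
        2 * K / δ * (64 / Δ ^ 2) * ((m + 1) * Δ ^ 2 / 64) := by field_simp
    have h4 := Real.log_le_sub_one_of_pos (show 0 < ((m : ℝ) + 1) * Δ ^ 2 / 64 by positivity)
    rw [e, Real.log_mul (by positivity) (by positivity)]
    linarith
  -- With `z = K / (δ * Δ) ≥ 2`, the numerical factor `2 ^ 7` is at most `z ^ 7` and the rest at
  -- most `z ^ 2`. Finally `576 = 2 * 32 * 9`.
  have h4 : Real.log (2 * K / δ * (64 / Δ ^ 2)) ≤ 9 * Real.log (K / (δ * Δ)) := by
    have hz : 2 ≤ K / (δ * Δ) := by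
      rw [le_div_iff₀ (by positivity)]
      have : δ * Δ ≤ 1 := mul_le_one₀ hδ1 hΔ.le hΔ1
      linarith
    have h5 : 2 * K / δ * (64 / Δ ^ 2) ≤ (K / (δ * Δ)) ^ 9 := by
      have h6 : (K : ℝ) / δ ≤ (K / δ) ^ 2 := by
        refine le_self_pow₀ ?_ two_ne_zero
        rw [le_div_iff₀ hδ]
        linarith
      calc 2 * K / δ * (64 / Δ ^ 2) = 2 ^ 7 * (K / δ / Δ ^ 2) := by ring
        _ ≤ (K / (δ * Δ)) ^ 7 * ((K / δ) ^ 2 / Δ ^ 2) := by gcongr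
        _ = (K / (δ * Δ)) ^ 9 := by rw [← div_pow, div_div]; ring
    have h7 := Real.log_le_log (by positivity) h5
    rw [Real.log_pow] at h7
    exact_mod_cast h7
  unfold BAI.complexity
  rw [← mul_div_assoc, le_div_iff₀ (by positivity)]
  linarith

/-! ### The elimination strategy -/

namespace Hist

variable {n : ℕ}

/-- The empirical mean of the rewards of an arm. -/
noncomputable def empMean (h : Hist K n) (i : Fin K) : ℝ := h.rewardSum i / h.count i

open Classical in
/-- The arms whose confidence interval is not entirely below that of another arm. -/
noncomputable def candidates (a : ℝ) (h : Hist K n) : Finset (Fin K) :=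
  Finset.univ.filter fun j =>
    ∀ i, h.empMean i - radius a (h.count i) ≤ h.empMean j + radius a (h.count j)

theorem mem_candidates {a : ℝ} {h : Hist K n} {j : Fin K} : j ∈ h.candidates a ↔
    ∀ i, h.empMean i - radius a (h.count i) ≤ h.empMean j + radius a (h.count j) := by
  simp [candidates]

theorem measurableSet_mem_candidates (a : ℝ) (j : Fin K) :
    MeasurableSet {h : Hist K n | j ∈ h.candidates a} := by
  have hm (i : Fin K) : Measurable fun h : Hist K n => h.empMean i :=
    (measurable_rewardSum i).div ((measurable_of_countable fun c : ℕ => (c : ℝ)).comp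
      (measurable_count i))
  have hr (i : Fin K) : Measurable fun h : Hist K n => radius a (h.count i) :=
    (measurable_of_countable (radius a)).comp (measurable_count i)
  have e : {h : Hist K n | j ∈ h.candidates a} = ⋂ i,
      {h | h.empMean i - radius a (h.count i) ≤ h.empMean j + radius a (h.count j)} := by
    ext h
    simp [mem_candidates]
  rw [e]
  exact MeasurableSet.iInter fun i =>
    measurableSet_le ((hm i).sub (hr i)) ((hm j).add (hr j))

/-- Rules that depend on the history only through counts and candidates are measurable. -/
theorem measurable_of_count_candidates {γ : Type*} [MeasurableSpace γ] (a : ℝ)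
    (G : (Fin K → ℕ) → Finset (Fin K) → γ) :
    Measurable fun h : Hist K n => G h.count (h.candidates a) := by
  let _ : MeasurableSpace (Finset (Fin K)) := ⊤
  have hc : Measurable fun h : Hist K n => h.candidates a := by
    refine measurable_to_countable' fun s => ?_
    have e : (fun h : Hist K n => h.candidates a) ⁻¹' {s} =
        ⋂ j, {h | j ∈ h.candidates a ↔ j ∈ s} := by
      ext h
      simp [Finset.ext_iff]
    rw [e]
    refine MeasurableSet.iInter fun j => ?_
    by_cases hj : j ∈ s
    · simpa only [hj, iff_true] using measurableSet_mem_candidates a j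
    · simpa only [hj, iff_false, Set.compl_ofPred] using (measurableSet_mem_candidates a j).compl
  have hcount : Measurable fun h : Hist K n => h.count :=
    measurable_pi_lambda _ fun i => measurable_count i
  have hG : Measurable fun p : (Fin K → ℕ) × Finset (Fin K) => G p.1 p.2 :=
    measurable_of_countable _
  exact hG.comp (hcount.prodMk hc)

end Hist

open Classical in
/-- An element of `s` where `c` is minimal, and `i₀` if `s` is empty. -/
noncomputable def argminOn (i₀ : Fin K) (c : Fin K → ℕ) (s : Finset (Fin K)) : Fin K :=
  if h : s.Nonempty then (s.exists_min_image c h).choose else i₀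

theorem argminOn_spec (i₀ : Fin K) (c : Fin K → ℕ) {s : Finset (Fin K)} (h : s.Nonempty) :
    argminOn i₀ c s ∈ s ∧ ∀ j ∈ s, c (argminOn i₀ c s) ≤ c j := by
  rw [argminOn, dif_pos h]
  exact (s.exists_min_image c h).choose_spec

/-- Pull a least pulled candidate, until at most one candidate is left; recommend it. -/
noncomputable def elimination (a : ℝ) (i₀ : Fin K) : BAI K Unit where
  sample _ _ h := argminOn i₀ h.count (h.candidates a)
  halt _ _ h := decide ((h.candidates a).card ≤ 1)
  recommend _ _ h := argminOn i₀ h.count (h.candidates a)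
  measurable_sample _ := (Hist.measurable_of_count_candidates a (argminOn i₀)).comp measurable_snd
  measurable_halt _ := (Hist.measurable_of_count_candidates a
    fun _ s => decide (s.card ≤ 1)).comp measurable_snd
  measurable_recommend _ :=
    (Hist.measurable_of_count_candidates a (argminOn i₀)).comp measurable_snd

/-- All the confidence intervals of a history contain the means. -/
noncomputable def Hist.Concentrated {n : ℕ} (a : ℝ) (ν : Fin K → Measure I) (h : Hist K n) : Prop :=
  ∀ i, |h.empMean i - mean ν i| ≤ radius a (h.count i)

section Deterministic

variable {n : ℕ} {a : ℝ} {ν : Fin K → Measure I} {iStar : Fin K} {h : Hist K n}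

theorem bestArm_mem_candidates (hb : IsBestArm ν iStar) (hc : h.Concentrated a ν) :
    iStar ∈ h.candidates a := by
  refine Hist.mem_candidates.2 fun i => ?_
  have h1 := abs_le.1 (hc i)
  have h2 := abs_le.1 (hc iStar)
  have h3 : mean ν i ≤ mean ν iStar := by
    by_cases hi : i = iStar
    · rw [hi]
    · exact (hb i hi).le
  linarith

/-- The gap of a candidate is at most twice the sum of the two radii. -/
theorem gap_le_of_mem_candidates (hc : h.Concentrated a ν) {j : Fin K}
    (hj : j ∈ h.candidates a) :
    gap ν iStar j ≤ 2 * radius a (h.count iStar) + 2 * radius a (h.count j) := by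
  have h1 := abs_le.1 (hc j)
  have h2 := abs_le.1 (hc iStar)
  have h3 := Hist.mem_candidates.1 hj iStar
  unfold gap
  linarith

/-- The best arm is a candidate too, so it has been pulled at least as often as `j` and its radius
is no larger. -/
theorem gap_le_of_argminOn_eq (ha : Real.exp 1 ≤ a) (hb : IsBestArm ν iStar)
    (hc : h.Concentrated a ν) {i₀ j : Fin K}
    (hj : argminOn i₀ h.count (h.candidates a) = j) :
    gap ν iStar j ≤ 4 * radius a (h.count j) := by
  have hs := bestArm_mem_candidates hb hc
  have h1 := argminOn_spec i₀ h.count ⟨_, hs⟩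
  rw [hj] at h1
  have h2 := gap_le_of_mem_candidates (iStar := iStar) hc h1.1
  have h3 := radius_antitone ha (h1.2 _ hs)
  linarith

/-- The best arm has no gap of its own to bound its pulls. Another surviving candidate, pulled at
least as often, supplies one. -/
theorem exists_gap_le_of_argminOn_eq (ha : Real.exp 1 ≤ a) (hc : h.Concentrated a ν) {i₀ : Fin K}
    (hj : argminOn i₀ h.count (h.candidates a) = iStar)
    (hcard : 1 < (h.candidates a).card) :
    ∃ j, j ≠ iStar ∧ gap ν iStar j ≤ 4 * radius a (h.count iStar) := by
  obtain ⟨j, hjc, hne⟩ := Finset.exists_mem_ne hcard iStar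
  have h1 := argminOn_spec i₀ h.count ⟨_, hjc⟩
  rw [hj] at h1
  have h2 := gap_le_of_mem_candidates (iStar := iStar) hc hjc
  have h3 := radius_antitone ha (h1.2 _ hjc)
  exact ⟨j, hne, by linarith⟩

end Deterministic

theorem sum_count {n : ℕ} (h : Hist K n) : ∑ i, h.count i = n := by
  have := Finset.card_eq_sum_card_fiberwise (f := fun k => (h k).1) (s := Finset.univ)
    (t := Finset.univ) fun _ _ => Finset.mem_coe.2 (Finset.mem_univ _)
  simpa [Hist.count] using this.symm

theorem notMem_recommendsWrong_elimination {ν : Fin K → Measure I}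
    {iStar i₀ : Fin K} {x : Table K} {a : ℝ} (hb : IsBestArm ν iStar)
    (hc : ∀ n, ((elimination a i₀).hist () x n).Concentrated a ν) :
    ((), x) ∉ (elimination a i₀).recommendsWrong iStar := by
  rintro ⟨n, hn, hne⟩
  have hs := bestArm_mem_candidates hb (hc n)
  have hcard : (((elimination a i₀).hist () x n).candidates a).card ≤ 1 := by
    simpa [elimination] using hn.1
  exact hne (Finset.card_le_one.1 hcard _ (argminOn_spec i₀ _ ⟨_, hs⟩).1 _ hs)

section Run

variable {ν : Fin K → Measure I} [∀ i, IsProbabilityMeasure (ν i)] {iStar i₀ : Fin K} {δ : ℝ}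
  {x : Table K}

theorem exp_one_le_two_mul_div (hK : 2 ≤ K) (hδ : 0 < δ) (hδ1 : δ ≤ 1) :
    Real.exp 1 ≤ 2 * K / δ := by
  have h1 := Real.exp_one_lt_d9
  have hK2 : (2 : ℝ) ≤ K := by exact_mod_cast hK
  rw [le_div_iff₀ hδ]
  nlinarith

/-- As long as the strategy runs and the confidence intervals are valid, the pulls are in budget. -/
theorem count_le_of_running (hK : 2 ≤ K) (hδ : 0 < δ) (hδ1 : δ ≤ 1) (hb : IsBestArm ν iStar)
    (hc : ∀ n, ((elimination (2 * K / δ) i₀).hist () x n).Concentrated (2 * K / δ) ν) (n : ℕ)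
    (hrun : ∀ m < n, (elimination (2 * K / δ) i₀).halt m ()
      ((elimination (2 * K / δ) i₀).hist () x m) = false) :
    (∀ j, j ≠ iStar → (((elimination (2 * K / δ) i₀).hist () x n).count j : ℝ) ≤
      576 * BAI.complexity K δ (gap ν iStar j)) ∧
    (((elimination (2 * K / δ) i₀).hist () x n).count iStar : ℝ) ≤
      576 * ∑ j ∈ Finset.univ.erase iStar, BAI.complexity K δ (gap ν iStar j) := by
  set E := elimination (2 * K / δ) i₀ with hE
  have ha := exp_one_le_two_mul_div hK hδ hδ1
  have hnn (j) (hj : j ≠ iStar) : 0 ≤ BAI.complexity K δ (gap ν iStar j) :=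
    complexity_nonneg (by omega) hδ hδ1 (hb.gap_pos hj) (gap_le_one ν _ _)
  have hsum : 0 ≤ ∑ j ∈ Finset.univ.erase iStar, BAI.complexity K δ (gap ν iStar j) :=
    Finset.sum_nonneg fun j hj => hnn j (Finset.ne_of_mem_erase hj)
  induction n with
  | zero =>
    refine ⟨fun j hj => ?_, ?_⟩
    · have := hnn j hj
      simpa [Hist.count] using this
    · simpa [Hist.count] using hsum
  | succ n ih =>
    obtain ⟨ih1, ih2⟩ := ih fun m hm => hrun m (hm.trans n.lt_succ_self)
    have hpull : E.sample n () (E.hist () x n) =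
      argminOn i₀ (E.hist () x n).count ((E.hist () x n).candidates (2 * K / δ)) := rfl
    refine ⟨fun j hj => ?_, ?_⟩
    · rw [BAI.hist, count_snoc]
      by_cases hs : E.sample n () (E.hist () x n) = j
      · rw [if_pos hs]
        push_cast
        rw [hpull] at hs
        -- The bound is on the count before the pull plus one, so it covers the new pull.
        exact succ_le_complexity hK hδ hδ1 (hb.gap_pos hj) (gap_le_one ν _ _)
          (gap_le_of_argminOn_eq ha hb (hc n) hs)
      · rw [if_neg hs]
        exact ih1 j hj
    · rw [BAI.hist, count_snoc]
      by_cases hs : E.sample n () (E.hist () x n) = iStar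
      · rw [if_pos hs]
        push_cast
        rw [hpull] at hs
        have hcard : 1 < ((E.hist () x n).candidates (2 * K / δ)).card := by
          have := hrun n n.lt_succ_self
          simpa [hE, elimination] using this
        obtain ⟨j, hj, hgap⟩ := exists_gap_le_of_argminOn_eq ha (hc n) hs hcard
        have h1 := succ_le_complexity hK hδ hδ1 (hb.gap_pos hj) (gap_le_one ν _ _) hgap
        -- The arm that is charged may change from pull to pull, hence the sum over all of them.
        have h2 := Finset.single_le_sum
          (f := fun j => BAI.complexity K δ (gap ν iStar j))
          (fun j hj => hnn j (Finset.ne_of_mem_erase hj))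
          (Finset.mem_erase.2 ⟨hj, Finset.mem_univ j⟩)
        linarith
      · rw [if_neg hs]
        exact ih2

/-- The suboptimal arms together and the best arm alone each use at most `576` times the sum. -/
theorem time_le_of_running (hK : 2 ≤ K) (hδ : 0 < δ) (hδ1 : δ ≤ 1) (hb : IsBestArm ν iStar)
    (hc : ∀ n, ((elimination (2 * K / δ) i₀).hist () x n).Concentrated (2 * K / δ) ν) (n : ℕ)
    (hrun : ∀ m < n, (elimination (2 * K / δ) i₀).halt m ()
      ((elimination (2 * K / δ) i₀).hist () x m) = false) :
    (n : ℝ) ≤ 1152 * ∑ j ∈ Finset.univ.erase iStar, BAI.complexity K δ (gap ν iStar j) := by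
  obtain ⟨h1, h2⟩ := count_le_of_running hK hδ hδ1 hb hc n hrun
  have h3 := sum_count ((elimination (2 * K / δ) i₀).hist () x n)
  rw [← Finset.add_sum_erase _ _ (Finset.mem_univ iStar)] at h3
  have h4 : ∑ j ∈ Finset.univ.erase iStar,
      (((elimination (2 * K / δ) i₀).hist () x n).count j : ℝ) ≤
      ∑ j ∈ Finset.univ.erase iStar, 576 * BAI.complexity K δ (gap ν iStar j) :=
    Finset.sum_le_sum fun j hj => h1 j (Finset.ne_of_mem_erase hj)
  rw [← Finset.mul_sum] at h4
  have h5 : (n : ℝ) = ((elimination (2 * K / δ) i₀).hist () x n).count iStar +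
      ∑ j ∈ Finset.univ.erase iStar,
        (((elimination (2 * K / δ) i₀).hist () x n).count j : ℝ) := by
    exact_mod_cast h3.symm
  linarith

theorem exists_stopsAt (hK : 2 ≤ K) (hδ : 0 < δ) (hδ1 : δ ≤ 1) (hb : IsBestArm ν iStar)
    (hc : ∀ n, ((elimination (2 * K / δ) i₀).hist () x n).Concentrated (2 * K / δ) ν) :
    ∃ n, (elimination (2 * K / δ) i₀).StopsAt () x n := by
  have hex : ∃ n, (elimination (2 * K / δ) i₀).halt n ()
      ((elimination (2 * K / δ) i₀).hist () x n) = true := by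
    by_contra! hno
    obtain ⟨n, hn⟩ := exists_nat_gt
      (1152 * ∑ j ∈ Finset.univ.erase iStar, BAI.complexity K δ (gap ν iStar j))
    exact absurd (time_le_of_running hK hδ hδ1 hb hc n fun m _ => by simpa using hno m)
      (not_le.2 hn)
  classical
  exact ⟨Nat.find hex, Nat.find_spec hex, fun m hm => by simpa using Nat.find_min hex hm⟩

theorem mem_stopsInBudget_elimination (hK : 2 ≤ K) (hδ : 0 < δ) (hδ1 : δ ≤ 1)
    (hb : IsBestArm ν iStar)
    (hc : ∀ n, ((elimination (2 * K / δ) i₀).hist () x n).Concentrated (2 * K / δ) ν) :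
    ((), x) ∈ (elimination (2 * K / δ) i₀).stopsInBudget ν iStar 1152 δ := by
  obtain ⟨n, hn⟩ := exists_stopsAt hK hδ hδ1 hb hc
  refine ⟨n, hn, fun j hj => ?_, time_le_of_running hK hδ hδ1 hb hc n hn.2⟩
  have h1 := (count_le_of_running hK hδ hδ1 hb hc n hn.2).1 j hj
  have h2 := complexity_nonneg (by omega : 1 ≤ K) hδ hδ1 (hb.gap_pos hj) (gap_le_one ν _ _)
  simp only at h1 ⊢
  linarith

end Run

/-! ### All confidence intervals are valid with high probability -/

section Union

variable (ν : Fin K → Measure I) [∀ i, IsProbabilityMeasure (ν i)]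

/-- The event that the empirical mean of `m` pulls of arm `i` leaves its confidence interval. -/
theorem measure_deviation_le {S : Type*} [MeasurableSpace S] (E : BAI K S) (s : S) {a : ℝ}
    (ha : 1 ≤ a) (i : Fin K) {m : ℕ} (hm : 1 ≤ m) :
    tableLaw ν {x | ∃ n, (E.hist s x n).count i = m ∧
      radius a m < |(E.hist s x n).empMean i - mean ν i|} ≤
    ENNReal.ofReal (2 / (a * (m + 1)) ^ 2) := by
  have hm1 : (1 : ℝ) ≤ m := by exact_mod_cast hm
  have hm0 : (0 : ℝ) < m := by linarith
  have h1 : 1 ≤ a * (m + 1) := by nlinarith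
  set r := radius a m with hr
  have hr0 : 0 ≤ r := radius_nonneg a m
  -- The choice `l = ±4 * r` minimises the Chernoff exponent for a deviation `m * r`, with value `-2
  -- * m * r ^ 2`. Since `m / (m + 1) ≥ 1 / 2`, this is at most `-2 * log (a * (m + 1))`.
  have hb (l : ℝ) (hl : l ^ 2 = 16 * r ^ 2) :
      ENNReal.ofReal (Real.exp (l ^ 2 / 8 * m - 4 * m * r ^ 2)) ≤
        ENNReal.ofReal (1 / (a * (m + 1)) ^ 2) := by
    refine ENNReal.ofReal_le_ofReal ?_
    have hlog := Real.log_nonneg h1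
    have hexp : l ^ 2 / 8 * m - 4 * m * r ^ 2 ≤ -(2 * Real.log (a * (m + 1))) := by
      rw [hl, hr, radius_sq ha]
      have e : 16 * (2 * (Real.log (a * (m + 1)) / (m + 1))) / 8 * m -
          4 * m * (2 * (Real.log (a * (m + 1)) / (m + 1))) =
          -(4 * (m * Real.log (a * (m + 1)) / (m + 1))) := by ring
      have h2 : Real.log (a * (m + 1)) ≤ 2 * (m * Real.log (a * (m + 1)) / (m + 1)) := by
        rw [← mul_div_assoc, le_div_iff₀ (by positivity)]
        nlinarith
      rw [e]
      linarith
    refine (Real.exp_le_exp.2 hexp).trans (le_of_eq ?_)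
    rw [Real.exp_neg, ← Real.log_rpow (by linarith), Real.exp_log (by positivity), one_div]
    norm_num
  have hsub : {x | ∃ n, (E.hist s x n).count i = m ∧
      r < |(E.hist s x n).empMean i - mean ν i|} ⊆
      {x | ∃ n, (E.hist s x n).count i = m ∧
        4 * m * r ^ 2 ≤ (4 * r) * ((E.hist s x n).rewardSum i - m * mean ν i)} ∪
      {x | ∃ n, (E.hist s x n).count i = m ∧
        4 * m * r ^ 2 ≤ (-(4 * r)) * ((E.hist s x n).rewardSum i - m * mean ν i)} := by
    rintro x ⟨n, hn, hdev⟩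
    have e : (E.hist s x n).rewardSum i - m * mean ν i =
        m * ((E.hist s x n).empMean i - mean ν i) := by
      rw [Hist.empMean, hn]
      field_simp
    rcases lt_abs.1 hdev with h | h
    · refine Or.inl ⟨n, hn, ?_⟩
      rw [e]
      nlinarith [mul_le_mul_of_nonneg_left h.le (mul_nonneg hm0.le hr0)]
    · refine Or.inr ⟨n, hn, ?_⟩
      rw [e]
      nlinarith [mul_le_mul_of_nonneg_left h.le (mul_nonneg hm0.le hr0)]
  calc _ ≤ _ := measure_mono hsub
    _ ≤ _ := measure_union_le _ _
    _ ≤ ENNReal.ofReal (1 / (a * (m + 1)) ^ 2) + ENNReal.ofReal (1 / (a * (m + 1)) ^ 2) :=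
        add_le_add
          ((E.measure_exists_dev_le s i m (4 * r) ν (4 * m * r ^ 2)).trans (hb _ (by ring)))
          ((E.measure_exists_dev_le s i m (-(4 * r)) ν (4 * m * r ^ 2)).trans (hb _ (by ring)))
    _ = ENNReal.ofReal (2 / (a * (m + 1)) ^ 2) := by
        rw [← ENNReal.ofReal_add (by positivity) (by positivity), ← add_div]
        norm_num

theorem tsum_ofReal_le {a : ℝ} (ha : 0 < a) :
    ∑' m : ℕ, ENNReal.ofReal (2 / (a * ((m + 1 : ℕ) + 1)) ^ 2) ≤ ENNReal.ofReal (4 / a ^ 2) := by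
  have hz := hasSum_zeta_two
  have hshift := (summable_nat_add_iff 2).2 hz.summable
  have hle : ∑' m : ℕ, (1 / ((m + 2 : ℕ) : ℝ) ^ 2) ≤ 2 := by
    have h1 : ∑' m : ℕ, (1 / ((m + 2 : ℕ) : ℝ) ^ 2) ≤ ∑' m : ℕ, (1 / (m : ℝ) ^ 2) := by
      rw [← hz.summable.sum_add_tsum_nat_add 2]
      exact le_add_of_nonneg_left (Finset.sum_nonneg fun _ _ => by positivity)
    rw [hz.tsum_eq] at h1
    have h2 := Real.pi_lt_d2
    have h3 := Real.pi_pos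
    nlinarith
  have e (m : ℕ) : 2 / (a * ((m + 1 : ℕ) + 1)) ^ 2 =
      2 / a ^ 2 * (1 / ((m + 2 : ℕ) : ℝ) ^ 2) := by
    push_cast
    rw [show (m : ℝ) + 1 + 1 = m + 2 by ring, mul_pow, div_mul_div_comm, mul_one]
  simp_rw [e]
  rw [← ENNReal.ofReal_tsum_of_nonneg (fun m => by positivity) (hshift.mul_left _), tsum_mul_left]
  refine ENNReal.ofReal_le_ofReal ?_
  calc _ ≤ 2 / a ^ 2 * 2 := mul_le_mul_of_nonneg_left hle (by positivity)
    _ = _ := by ring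

/-- The union runs over arms and positive counts, not over time. Its total is `K * (4 / a ^ 2) = δ ^
2 / K`, whence the choice `a = 2 * K / δ`. -/
theorem measure_not_concentrated_le {S : Type*} [MeasurableSpace S] (E : BAI K S) (s : S)
    {δ : ℝ} (hK : 2 ≤ K) (hδ : 0 < δ) (hδ1 : δ ≤ 1) :
    tableLaw ν {x | ∃ n, ¬ (E.hist s x n).Concentrated (2 * K / δ) ν} ≤ ENNReal.ofReal δ := by
  set a : ℝ := 2 * K / δ with ha
  have hexp : Real.exp 1 ≤ a := exp_one_le_two_mul_div hK hδ hδ1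
  have ha1 : 1 ≤ a := (Real.one_le_exp zero_le_one).trans hexp
  have ha0 : 0 < a := by linarith
  have hK2 : (2 : ℝ) ≤ K := by exact_mod_cast hK
  have hsub : {x | ∃ n, ¬ (E.hist s x n).Concentrated a ν} ⊆
      ⋃ i : Fin K, ⋃ m : ℕ, {x | ∃ n, (E.hist s x n).count i = m + 1 ∧
        radius a (m + 1) < |(E.hist s x n).empMean i - mean ν i|} := by
    rintro x ⟨n, hn⟩
    simp only [Hist.Concentrated, not_forall, not_le] at hn
    obtain ⟨i, hi⟩ := hn
    refine Set.mem_iUnion.2 ⟨i, ?_⟩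
    rcases hcount : (E.hist s x n).count i with _ | m
    · exfalso
      rw [hcount, Hist.empMean, hcount, Nat.cast_zero, div_zero, zero_sub, abs_neg,
        abs_of_nonneg (mean_nonneg ν i)] at hi
      linarith [one_le_radius_zero hexp, mean_le_one ν i]
    · rw [hcount] at hi
      exact Set.mem_iUnion.2 ⟨m, n, hcount, hi⟩
  calc _ ≤ _ := measure_mono hsub
    _ ≤ ∑ i : Fin K, _ := measure_iUnion_fintype_le _ _
    _ ≤ ∑ _i : Fin K, ENNReal.ofReal (4 / a ^ 2) := by
        refine Finset.sum_le_sum fun i _ => ?_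
        refine (measure_iUnion_le _).trans ((ENNReal.tsum_le_tsum fun m => ?_).trans
          (tsum_ofReal_le ha0))
        exact measure_deviation_le ν E s ha1 i (Nat.le_add_left 1 m)
    _ = ENNReal.ofReal (K * (4 / a ^ 2)) := by
        rw [Finset.sum_const, Finset.card_fin, nsmul_eq_mul, ENNReal.ofReal_mul (by positivity),
          ENNReal.ofReal_natCast]
    _ ≤ ENNReal.ofReal δ := by
        refine ENNReal.ofReal_le_ofReal ?_
        have e : K * (4 / a ^ 2) = δ ^ 2 / K := by
          rw [ha]
          field_simp
          ring
        rw [e, div_le_iff₀ (by linarith)]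
        nlinarith

end Union

/-- A wrong recommendation and an exceeded budget both force some interval to be invalid, so one
event of probability at most `δ` covers both requirements. -/
theorem elimination_isFixedConfidence {δ : ℝ} (hK : 2 ≤ K) (hδ : 0 < δ) (hδ1 : δ ≤ 1)
    (i₀ : Fin K) :
    (elimination (2 * K / δ) i₀).IsFixedConfidence (Measure.dirac ()) 1152 δ := by
  have hfst (ν : Fin K → Measure I) [∀ i, IsProbabilityMeasure (ν i)] :
      ((Measure.dirac ()).prod (tableLaw ν)) {p | ∃ n,
        ¬ ((elimination (2 * K / δ) i₀).hist p.1 p.2 n).Concentrated (2 * K / δ) ν} ≤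
      ENNReal.ofReal δ := by
    rw [Measure.dirac_prod]
    -- A measurable equivalence transports the measure of arbitrary sets, so the event need not be
    -- shown measurable.
    refine ((MeasurableEquiv.punitProd (α := Table K)).symm.map_apply _).le.trans ?_
    exact measure_not_concentrated_le ν (elimination (2 * K / δ) i₀) () hK hδ hδ1
  constructor
  · intro ν _ iStar hb
    refine (measure_mono ?_).trans (hfst ν)
    rintro ⟨⟨⟩, x⟩ hx
    by_contra hno
    simp only [Set.mem_ofPred_eq, not_exists, not_not] at hno
    exact notMem_recommendsWrong_elimination hb hno hx
  · intro ν _ iStar hb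
    set P := (Measure.dirac ()).prod (tableLaw ν)
    set G := (elimination (2 * K / δ) i₀).stopsInBudget ν iStar 1152 δ
    have h1 : P Gᶜ ≤ ENNReal.ofReal δ := by
      refine (measure_mono ?_).trans (hfst ν)
      rintro ⟨⟨⟩, x⟩ hx
      by_contra hno
      simp only [Set.mem_ofPred_eq, not_exists, not_not] at hno
      exact hx (mem_stopsInBudget_elimination hK hδ hδ1 hb hno)
    have hG : MeasurableSet G := BAI.measurableSet_stopsInBudget _ ν iStar _ _
    have h2 := prob_add_prob_compl (μ := P) hG
    rw [ENNReal.ofReal_sub _ hδ.le, ENNReal.ofReal_one]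
    refine tsub_le_iff_right.2 ?_
    rw [← h2]
    exact add_le_add le_rfl h1

end SecureBandit

theorem mainTheorem8 :
    (∀ C : ℝ, ∃ C' : ℝ, ∀ (K T : ℕ), 2 ≤ K → 2 ≤ T →
      ∀ (S : Type*) [MeasurableSpace S] (ρ : Measure S) [IsProbabilityMeasure ρ]
        (A : Type*) [MeasurableSpace A] (α : Measure A) [IsProbabilityMeasure α]
        (E : SecureBandit.BAI K S), E.IsFixedConfidence ρ C (1 / (T : ℝ)) →
      ∀ (B : SecureBandit.Attacker K A)
        (ν : Fin K → Measure unitInterval) [∀ i, IsProbabilityMeasure (ν i)] (iStar : Fin K),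
        SecureBandit.IsBestArm ν iStar →
        SecureBandit.regret E.exploreThenCommit B ρ α ν iStar T ≤
            C' * ∑ j ∈ Finset.univ.erase iStar,
              Real.log T / SecureBandit.gap ν iStar j ∧
          SecureBandit.expectedVerifications E.exploreThenCommit B ρ α ν T ≤
            C' * ∑ j ∈ Finset.univ.erase iStar,
              Real.log T / SecureBandit.gap ν iStar j ^ 2) ∧
    (∃ C : ℝ, ∀ (K : ℕ) (δ : ℝ), 2 ≤ K → 0 < δ → δ < 1 →
      ∃ E : SecureBandit.BAI K Unit, E.IsFixedConfidence (Measure.dirac ()) C δ) := by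
  refine ⟨fun C => ⟨3 * |C| + 6, ?_⟩, 1152, fun K δ hK hδ hδ1 => ?_⟩
  · intro K T hK hT S _ ρ _ A _ α _ E hE B ν _ iStar hb
    simpa only [pow_one] using SecureBandit.exploreThenCommit_bounds ρ α hK hT E hE B ν hb
  · exact ⟨_, SecureBandit.elimination_isFixedConfidence hK hδ hδ1.le ⟨0, by omega⟩⟩
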